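/- Let $m,\ell$ be integers with $1\le \ell<m$, and let $n=m+\lceil\log_2 m\rceil$ (so $n=m+\log_2 m$ when $m$ is a power of two). A function $f:\{0,1\}^m\to\{0,1\}^m$ is $V$-invariant, for a linear subspace $V\subseteq\mathbb F_2^m$, if for all $x,y$: $f(x)=f(y)$ if and only if $x=y\oplus v$ for some $v\in V$. View $f$ as the concept (Boolean function) on $\{0,1\}^n$ given by $(x,j)\mapsto f(x)_j$, where $j$ is one of the $m$ indices, encoded in binary by the last $\lceil\log_2 m\rceil$ bits (value $0$ if these bits encode no index). Let $C$ be the class of the concepts of all functions that are $V$-invariant for some $\ell$-dimensional subspace $V$ of $\mathbb F_2^m$, and let $\mathscr P$ consist of one piece for each $\ell$-dimensional $V$, namely the concepts of the $V$-invariant functions. Write $R_{\mathscr P}(C)$ and $Q_{\mathscr P}(C)$ for the least number of queries (worst case) of a classical randomized, respectively quantum, query algorithm that, given a membership oracle for an unknown $c\in C$, outputs the piece of $\mathscr P$ containing $c$ with probability at least $2/3$ for every $c\in C$. Then $\mathscr P$ is a partition of $C$ into nonempty disjoint pieces, and 1. $|C|<2^{m\ell-\ell^2+\ell+m2^{m-\ell}}$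 and $|\mathscr P|>2^{m\ell-\ell^2-\ell}$; 2. $R_{\mathscr P}(C)=2^{\Omega(m-\ell)}$; precisely, there is an absolute constant $\kappa>0$ such that $R_{\mathscr P}(C)\ge \kappa\,2^{(m-\ell)/3}$ for all $1\le\ell<m$; 3. $Q_{\mathscr P}(C)=\mathrm{poly}(m)$: there is a polynomial $p$, independent of $m$ and $\ell$, such that $Q_{\mathscr P}(C)\le p(m)$ for all $1\le\ell<m$. 4. Consequently, if $\ell=\ell(m)$ satisfies $1\le\ell(m)<m$ for all large $m$ and $m-\ell(m)=\omega(\log m)$, then the gap is superpolynomial: for every $k$, both $R_{\mathscr P}(C)>m^k$ and $R_{\mathscr P}(C)>Q_{\mathscr P}(C)^k$ hold for all sufficiently large $m$. -/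

import Mathlib

open Filter Asymptotics
open scoped ENNReal

/-! ### Concepts and partitions of concept classes -/

/-- The cube `{0,1}^n`, identified with the vector space `𝔽₂^n`. -/
abbrev Cube (n : ℕ) : Type := Fin n → ZMod 2

/-- A concept over `{0,1}^n` is a Boolean function on `{0,1}^n`. -/
abbrev BoolConcept (n : ℕ) : Type := Cube n → ZMod 2

/-- `P` is a collection of nonempty pairwise disjoint sets of concepts whose union is `C`. -/
structure IsConceptPartition {n : ℕ} (C : Set (BoolConcept n)) (P : Set (Set (BoolConcept n))) : Prop where
  nonempty : ∀ S ∈ P, S.Nonempty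
  disjoint : ∀ S ∈ P, ∀ S' ∈ P, S ≠ S' → Disjoint S S'
  sUnion_eq : ⋃₀ P = C

/-- The answer `S` is correct for the target concept `c`: it is the piece of `P` containing `c`. -/
def CorrectPiece {n : ℕ} (P : Set (Set (BoolConcept n))) (c : BoolConcept n) (S : Set (BoolConcept n)) : Prop :=
  S ∈ P ∧ c ∈ S

/-! ### Classical randomized query algorithms -/

/-- A deterministic adaptive query algorithm over `{0,1}^n` with answers in `O`: either it stops
with an answer, or it queries a point and goes on according to the bit received
(first subtree for `0`, second subtree for `1`). -/
inductive QueryTree (n : ℕ) (O : Type) : Type where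
  | answer (o : O) : QueryTree n O
  | query (x : Cube n) (onZero onOne : QueryTree n O) : QueryTree n O

/-- The answer of the algorithm when the oracle is `c`. -/
def QueryTree.run {n : ℕ} {O : Type} (c : BoolConcept n) : QueryTree n O → O
  | .answer o => o
  | .query x t₀ t₁ => if c x = 0 then t₀.run c else t₁.run c

/-- The worst-case number of queries. -/
def QueryTree.depth {n : ℕ} {O : Type} : QueryTree n O → ℕ
  | .answer _ => 0
  | .query _ t₀ t₁ => max t₀.depth t₁.depth + 1

/-- Some classical randomized algorithm (a probability distribution on deterministic ones) making
at most `T` queries outputs, for every target `c ∈ C`, the piece of `P` containing `c` with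
probability at least `2/3`. -/
def ClassicallyLearnable {n : ℕ} (C : Set (BoolConcept n)) (P : Set (Set (BoolConcept n))) (T : ℕ) : Prop :=
  ∃ A : PMF (QueryTree n (Set (BoolConcept n))),
    (∀ t ∈ A.support, t.depth ≤ T) ∧
    ∀ c ∈ C, (2 / 3 : ℝ≥0∞) ≤ A.toOuterMeasure {t | CorrectPiece P c (t.run c)}

/-- `R_P(C)`: the optimal classical randomized query complexity of the partition problem. -/
noncomputable def classicalComplexity {n : ℕ} (C : Set (BoolConcept n)) (P : Set (Set (BoolConcept n))) : ℕ :=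
  sInf {T | ClassicallyLearnable C P T}

/-! ### Quantum query algorithms -/

/-- Computational basis states `|x, b, w⟩`: a query register `x ∈ {0,1}^n`, an answer
bit `b`, and a work register `w` of arbitrary finite dimension `d`. -/
abbrev QBasis (n d : ℕ) : Type := Cube n × ZMod 2 × Fin d

/-- The quantum membership oracle, the linear map with `|x, b, w⟩ ↦ |x, b ⊕ c x, w⟩`.
As this permutation of the basis is an involution, the amplitude of the image of `ψ` at `|x, b, w⟩`
is the amplitude of `ψ` at `|x, b ⊕ c x, w⟩`. -/
def quantumOracle {n d : ℕ} (c : BoolConcept n) (ψ : QBasis n d → ℂ) : QBasis n d → ℂ :=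
  fun z => ψ (z.1, z.2.1 + c z.1, z.2.2)

/-- A quantum query algorithm with answers in `O`: fixed unitaries `U 0, U 1, …`, an initial basis
state, and the answer read off from a basis state found by the final measurement. -/
structure QuantumAlgorithm (n : ℕ) (O : Type) : Type where
  d : ℕ
  U : ℕ → Matrix.unitaryGroup (QBasis n d) ℂ
  start : QBasis n d
  output : QBasis n d → O

/-- The state after `U 0, QMQ_c, U 1, QMQ_c, …, QMQ_c, U T`, in which the oracle
is invoked `T` times. -/
noncomputable def QuantumAlgorithm.state {n : ℕ} {O : Type} (A : QuantumAlgorithm n O)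
    (c : BoolConcept n) : ℕ → QBasis n A.d → ℂ
  | 0 => (A.U 0 : Matrix (QBasis n A.d) (QBasis n A.d) ℂ).mulVec (Pi.single A.start 1)
  | T + 1 => (A.U (T + 1) : Matrix (QBasis n A.d) (QBasis n A.d) ℂ).mulVec
      (quantumOracle c (A.state c T))

open Classical in
/-- The probability that measuring the state after `T` queries to `c` gives an answer
satisfying `good`. -/
noncomputable def QuantumAlgorithm.prob {n : ℕ} {O : Type} (A : QuantumAlgorithm n O)
    (c : BoolConcept n) (T : ℕ) (good : O → Prop) : ℝ :=
  ∑ z : QBasis n A.d, if good (A.output z) then ‖A.state c T z‖ ^ 2 else 0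

/-- Some quantum algorithm making `T` queries outputs, for every target `c ∈ C`, the piece of `P`
containing `c` with probability at least `2/3`. -/
def QuantumLearnable {n : ℕ} (C : Set (BoolConcept n)) (P : Set (Set (BoolConcept n))) (T : ℕ) : Prop :=
  ∃ A : QuantumAlgorithm n (Set (BoolConcept n)),
    ∀ c ∈ C, 2 / 3 ≤ A.prob c T (CorrectPiece P c)

/-- `Q_P(C)`: the optimal quantum query complexity of the partition problem. -/
noncomputable def quantumComplexity {n : ℕ} (C : Set (BoolConcept n)) (P : Set (Set (BoolConcept n))) : ℕ :=
  sInf {T | QuantumLearnable C P T}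

/-! ### The concept class of `V`-invariant functions -/

/-- `f x = f y` if and only if `x = y ⊕ v` for some `v ∈ V`. -/
def IsInvariantFunction {m : ℕ} (V : Submodule (ZMod 2) (Cube m)) (f : Cube m → Cube m) : Prop :=
  ∀ x y, f x = f y ↔ ∃ v ∈ V, x = y + v

/-- The number of bits of an input `(x, j)` with `x ∈ {0,1}^m` and `j` one of `m` indices:
`m + ⌈log₂ m⌉`, which is `m + log₂ m` when `m` is a power of two. -/
def inputLength (m : ℕ) : ℕ := m + Nat.clog 2 m

/-- The first `m` bits of an input. -/
def inputPoint {m : ℕ} (p : Cube (inputLength m)) : Cube m :=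
  fun i => p (Fin.castAdd (Nat.clog 2 m) i)

/-- The last `⌈log₂ m⌉` bits of an input, read as a binary number. -/
def inputIndex {m : ℕ} (p : Cube (inputLength m)) : ℕ :=
  ∑ i : Fin (Nat.clog 2 m), (p (Fin.natAdd m i)).val * 2 ^ (i : ℕ)

/-- The function `f : {0,1}^m → {0,1}^m` viewed as the concept `(x, j) ↦ f(x)_j`. If `m` is not a
power of two, the inputs whose last bits do not encode one of the `m` indices get the value `0`. -/
def bitConcept {m : ℕ} (f : Cube m → Cube m) : BoolConcept (inputLength m) :=
  fun p => if h : inputIndex p < m then f (inputPoint p) ⟨inputIndex p, h⟩ else 0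

/-- The concepts of the `V`-invariant functions. -/
def invariantPiece {m : ℕ} (V : Submodule (ZMod 2) (Cube m)) : Set (BoolConcept (inputLength m)) :=
  {c | ∃ f, IsInvariantFunction V f ∧ c = bitConcept f}

/-- The concepts of all functions that are `V`-invariant for some `ℓ`-dimensional `V`. -/
def invariantClass (m ℓ : ℕ) : Set (BoolConcept (inputLength m)) :=
  {c | ∃ V : Submodule (ZMod 2) (Cube m), Module.finrank (ZMod 2) V = ℓ ∧ c ∈ invariantPiece V}

/-- The division of this class into one piece for every `ℓ`-dimensional subspace `V`. -/
def invariantPartition (m ℓ : ℕ) : Set (Set (BoolConcept (inputLength m))) :=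
  {S | ∃ V : Submodule (ZMod 2) (Cube m), Module.finrank (ZMod 2) V = ℓ ∧ S = invariantPiece V}

/-!
The four claims rest on three independent arguments.

*Counting.* An ordered basis of an `ℓ`-dimensional subspace is a linearly independent `ℓ`-tuple, so
the number of subspaces times `∏ (2^ℓ - 2^i)` is `∏ (2^m - 2^i)` (`card_subspaces_mul`); both
cardinality bounds follow by comparing factors, because the `V`-invariant functions are the
injective functions on the quotient by `V`.

*Classical lower bound.* For every `V` fix a linear map `g V` with kernel `V`; then `σ ∘ g V` is
`V`-invariant for every permutation `σ` of the cube. For random `σ`, an algorithm that has not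
queried two points congruent modulo `V` sees the same distribution of answers on `σ ∘ g V` as on `σ`
(`card_separatedRun_comp`), and the latter carries no information on `V`. For random `V`, two
given points are congruent modulo `V` with probability at most `2^ℓ / 2^m`
(`card_subspaces_mem_mul_le`). So `T` queries find `V` with probability at most
`1 / #subspaces + T² 2^ℓ / 2^m`, and since there are at least two subspaces, success probability
`2/3` forces `2^(m - ℓ) ≤ 6 T²` (`two_pow_le_of_classicallyLearnable`), which is more than enough.

*Quantum upper bound.* Simon's algorithm is run on `m + 2` samples in parallel: prepare a uniform
superposition of matrices `x` with `m + 2` rows in `𝔽₂^m`, query all bits of the values of `f` at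
the rows, and apply the Hadamard transform to `x`. The answers stay in memory, so only branches
in the same coset of `V^(m + 2)` interfere, and the measured rows are independent uniform
elements of the orthogonal complement of `V` (`fourierSampling_prob`). A vector outside `V` is
orthogonal to all of them with probability at most `2^(-(m + 2))`; by the union bound their common
kernel is `V` with probability at least `3/4` (`card_good_samples_ge`).

The superpolynomial gap compares the bounds `2^((m - ℓ)/3) / 3` and `(m + 2) m`.
-/

/-! ### Counting subspaces of `𝔽₂^m` -/

/-- The type of `ℓ`-dimensional subspaces of `𝔽₂^m`. -/
abbrev Subspaces (m ℓ : ℕ) : Type :=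
  {V : Submodule (ZMod 2) (Cube m) // Module.finrank (ZMod 2) V = ℓ}

instance (m ℓ : ℕ) : Finite (Subspaces m ℓ) :=
  Finite.of_injective (fun V => ((V : Submodule (ZMod 2) (Cube m)) : Set (Cube m)))
    (SetLike.coe_injective.comp Subtype.val_injective)

lemma card_cube (m : ℕ) : Nat.card (Cube m) = 2 ^ m := by
  simp [Nat.card_eq_fintype_card]

lemma card_submodule {m : ℕ} (V : Submodule (ZMod 2) (Cube m)) :
    Nat.card V = 2 ^ Module.finrank (ZMod 2) V := by
  rw [Module.natCard_eq_pow_finrank (K := ZMod 2)]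
  simp

/-- Double counting of the linearly independent `ℓ`-tuples in `𝔽₂^m` according to their spans. -/
lemma card_subspaces_mul {m ℓ : ℕ} (h : ℓ ≤ m) :
    Nat.card (Subspaces m ℓ) * ∏ i : Fin ℓ, (2 ^ ℓ - 2 ^ (i : ℕ)) =
      ∏ i : Fin ℓ, (2 ^ m - 2 ^ (i : ℕ)) := by
  classical
  let F : (Σ V : Subspaces m ℓ, {s : Fin ℓ → V.1 // LinearIndependent (ZMod 2) s}) →
      {s : Fin ℓ → Cube m // LinearIndependent (ZMod 2) s} :=
    fun p => ⟨fun i => (p.2.1 i : Cube m), p.2.2.map' p.1.1.subtype (Submodule.ker_subtype _)⟩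
  have hspan : ∀ p, Submodule.span (ZMod 2) (Set.range (F p).1) = p.1.1 := fun p => by
    refine Submodule.eq_of_le_of_finrank_eq ?_ ?_
    · rw [Submodule.span_le]
      rintro _ ⟨i, rfl⟩
      exact (p.2.1 i).2
    · rw [finrank_span_eq_card (F p).2, p.1.2, Fintype.card_fin]
  have hF : F.Bijective := by
    constructor
    · rintro ⟨V, s⟩ ⟨W, t⟩ hst
      have hVW : V = W := Subtype.ext (by rw [← hspan ⟨V, s⟩, hst, hspan])
      subst hVW
      have : s = t := by
        apply Subtype.ext
        funext i
        apply Subtype.ext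
        exact congrFun (congrArg Subtype.val hst) i
      rw [this]
    · rintro ⟨s, hs⟩
      refine ⟨⟨⟨Submodule.span (ZMod 2) (Set.range s), ?_⟩,
        fun i => ⟨s i, Submodule.subset_span ⟨i, rfl⟩⟩, ?_⟩, rfl⟩
      · rw [finrank_span_eq_card hs, Fintype.card_fin]
      · exact linearIndependent_span hs
  have h1 := Nat.card_congr (Equiv.ofBijective F hF)
  have h2 : ∀ V : Subspaces m ℓ, Nat.card {s : Fin ℓ → V.1 // LinearIndependent (ZMod 2) s} =
      ∏ i : Fin ℓ, (2 ^ ℓ - 2 ^ (i : ℕ)) := fun V => by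
    rw [card_linearIndependent V.2.ge, V.2]
    simp
  have := Fintype.ofFinite (Subspaces m ℓ)
  rw [Nat.card_sigma, Finset.sum_congr rfl fun V _ => h2 V,
    card_linearIndependent (by simpa using h)] at h1
  simpa [Nat.card_eq_fintype_card] using h1

lemma prod_two_pow_sub_pos (ℓ : ℕ) : 0 < ∏ i : Fin ℓ, (2 ^ ℓ - 2 ^ (i : ℕ)) :=
  Finset.prod_pos fun i _ => Nat.sub_pos_of_lt (Nat.pow_lt_pow_right (by norm_num) i.2)

lemma le_card_subspaces {m ℓ : ℕ} (h : ℓ ≤ m) :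
    2 ^ ((m - ℓ) * ℓ) ≤ Nat.card (Subspaces m ℓ) := by
  refine Nat.le_of_mul_le_mul_right ?_ (prod_two_pow_sub_pos ℓ)
  rw [card_subspaces_mul h, pow_mul, ← Fin.prod_const ℓ (2 ^ (m - ℓ)), ← Finset.prod_mul_distrib]
  refine Finset.prod_le_prod' fun i _ => ?_
  rw [Nat.mul_sub, ← pow_add, Nat.sub_add_cancel h]
  exact Nat.sub_le_sub_left (Nat.le_mul_of_pos_left _ (by positivity)) _

lemma card_subspaces_le {m ℓ : ℕ} (h : ℓ ≤ m) :
    Nat.card (Subspaces m ℓ) ≤ 2 ^ (m * ℓ - ℓ ^ 2 + ℓ) := by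
  rcases Nat.eq_zero_or_pos ℓ with rfl | hℓ
  · simpa using (card_subspaces_mul h).le
  have hprod : 2 ^ ((ℓ - 1) * ℓ) ≤ ∏ i : Fin ℓ, (2 ^ ℓ - 2 ^ (i : ℕ)) := by
    rw [pow_mul, ← Fin.prod_const ℓ (2 ^ (ℓ - 1))]
    refine Finset.prod_le_prod' fun i _ => ?_
    have h1 : 2 ^ (i : ℕ) ≤ 2 ^ (ℓ - 1) := Nat.pow_le_pow_right (by norm_num) (by omega)
    have h2 : 2 ^ ℓ = 2 ^ (ℓ - 1) + 2 ^ (ℓ - 1) := by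
      rw [← mul_two, ← pow_succ, Nat.sub_add_cancel hℓ]
    omega
  have htot : ∏ i : Fin ℓ, (2 ^ m - 2 ^ (i : ℕ)) ≤ 2 ^ (m * ℓ) := by
    rw [pow_mul, ← Fin.prod_const ℓ (2 ^ m)]
    exact Finset.prod_le_prod' fun i _ => Nat.sub_le _ _
  refine Nat.le_of_mul_le_mul_right ?_ (by positivity : 0 < 2 ^ ((ℓ - 1) * ℓ))
  calc _ ≤ Nat.card (Subspaces m ℓ) * ∏ i : Fin ℓ, (2 ^ ℓ - 2 ^ (i : ℕ)) :=
        Nat.mul_le_mul_left _ hprod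
    _ ≤ 2 ^ (m * ℓ) := (card_subspaces_mul h).trans_le htot
    _ = _ := by
        rw [← pow_add]
        congr 1
        have : ℓ ^ 2 ≤ m * ℓ := by rw [sq]; exact Nat.mul_le_mul_right _ h
        have h3 : (ℓ - 1) * ℓ + ℓ = ℓ ^ 2 := by
          obtain ⟨k, rfl⟩ := Nat.exists_eq_add_of_lt hℓ
          simp
          ring
        omega

lemma two_le_card_subspaces {m ℓ : ℕ} (h1 : 1 ≤ ℓ) (h2 : ℓ < m) :
    2 ≤ Nat.card (Subspaces m ℓ) :=
  le_trans (Nat.le_self_pow (Nat.mul_pos (by omega) h1).ne' 2) (le_card_subspaces h2.le)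

/-! ### Invariant functions and their concepts -/

/-- The input `(x, j)`, with `j` written in binary in the last bits. -/
noncomputable def encodeInput {m : ℕ} (x : Cube m) (j : Fin m) : Cube (inputLength m) :=
  Fin.append x
    (finFunctionFinEquiv.symm ⟨j, j.2.trans_le (Nat.le_pow_clog (by norm_num) m)⟩ :
      Fin (Nat.clog 2 m) → Fin 2)

@[simp] lemma inputPoint_encodeInput {m : ℕ} (x : Cube m) (j : Fin m) :
    inputPoint (encodeInput x j) = x := by
  funext i
  exact Fin.append_left _ _ _

@[simp] lemma inputIndex_encodeInput {m : ℕ} (x : Cube m) (j : Fin m) :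
    inputIndex (encodeInput x j) = j := by
  have h := finFunctionFinEquiv_apply (finFunctionFinEquiv.symm
    ⟨j, j.2.trans_le (Nat.le_pow_clog (by norm_num) m)⟩ : Fin (Nat.clog 2 m) → Fin 2)
  rw [Equiv.apply_symm_apply] at h
  rw [inputIndex, h]
  refine Finset.sum_congr rfl fun i _ => ?_
  congr 1
  exact congrArg ZMod.val (Fin.append_right _ _ _)

@[simp] lemma bitConcept_encodeInput {m : ℕ} (f : Cube m → Cube m) (x : Cube m) (j : Fin m) :
    bitConcept f (encodeInput x j) = f x j := by
  simp [bitConcept]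

lemma bitConcept_injective (m : ℕ) :
    Function.Injective (bitConcept : (Cube m → Cube m) → BoolConcept (inputLength m)) := by
  intro f g h
  funext x j
  rw [← bitConcept_encodeInput f, h, bitConcept_encodeInput]

lemma IsInvariantFunction.mem_iff {m : ℕ} {V : Submodule (ZMod 2) (Cube m)} {f : Cube m → Cube m}
    (h : IsInvariantFunction V f) (v : Cube m) : v ∈ V ↔ f v = f 0 := by
  rw [h v 0]
  constructor
  · exact fun hv => ⟨v, hv, by simp⟩
  · rintro ⟨w, hw, rfl⟩
    simpa using hw

lemma IsInvariantFunction.eq_iff_sub_mem {m : ℕ} {V : Submodule (ZMod 2) (Cube m)}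
    {f : Cube m → Cube m} (h : IsInvariantFunction V f) (x y : Cube m) :
    f x = f y ↔ x - y ∈ V := by
  rw [h x y]
  constructor
  · rintro ⟨w, hw, rfl⟩
    simpa using hw
  · exact fun hv => ⟨x - y, hv, by abel⟩

/-- The subspace under which a function is invariant is determined by the function. -/
lemma IsInvariantFunction.unique {m : ℕ} {V W : Submodule (ZMod 2) (Cube m)}
    {f : Cube m → Cube m} (hV : IsInvariantFunction V f) (hW : IsInvariantFunction W f) :
    V = W := by
  ext v
  rw [hV.mem_iff, hW.mem_iff]

lemma exists_linearMap_ker_eq {m : ℕ} (V : Submodule (ZMod 2) (Cube m)) :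
    ∃ g : Cube m →ₗ[ZMod 2] Cube m, LinearMap.ker g = V := by
  obtain ⟨W, h⟩ := V.exists_isCompl
  refine ⟨W.subtype ∘ₗ W.projectionOnto V h.symm, ?_⟩
  rw [LinearMap.ker_comp, Submodule.ker_subtype]
  exact Submodule.ker_projectionOnto h.symm

lemma isInvariantFunction_perm_comp {m : ℕ} (σ : Equiv.Perm (Cube m))
    (g : Cube m →ₗ[ZMod 2] Cube m) :
    IsInvariantFunction (LinearMap.ker g) (σ ∘ g) := by
  intro x y
  rw [Function.comp_apply, Function.comp_apply, σ.injective.eq_iff, ← sub_eq_zero, ← map_sub]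
  constructor
  · exact fun h => ⟨x - y, h, by abel⟩
  · rintro ⟨v, hv, rfl⟩
    simpa using hv

lemma invariantPiece_nonempty {m : ℕ} (V : Submodule (ZMod 2) (Cube m)) :
    (invariantPiece V).Nonempty := by
  obtain ⟨g, rfl⟩ := exists_linearMap_ker_eq V
  exact ⟨_, _, isInvariantFunction_perm_comp (Equiv.refl _) g, rfl⟩

lemma eq_of_mem_invariantPiece {m : ℕ} {V W : Submodule (ZMod 2) (Cube m)}
    {c : BoolConcept (inputLength m)} (hV : c ∈ invariantPiece V) (hW : c ∈ invariantPiece W) :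
    V = W := by
  obtain ⟨f, hf, rfl⟩ := hV
  obtain ⟨g, hg, hfg⟩ := hW
  rw [← bitConcept_injective m hfg] at hg
  exact hf.unique hg

lemma invariantPiece_injective (m : ℕ) :
    Function.Injective (invariantPiece (m := m)) := by
  intro V W h
  obtain ⟨c, hc⟩ := invariantPiece_nonempty V
  exact eq_of_mem_invariantPiece hc (h ▸ hc)

lemma isConceptPartition_invariant (m ℓ : ℕ) :
    IsConceptPartition (invariantClass m ℓ) (invariantPartition m ℓ) where
  nonempty := by
    rintro _ ⟨V, -, rfl⟩
    exact invariantPiece_nonempty V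
  disjoint := by
    rintro _ ⟨V, -, rfl⟩ _ ⟨W, -, rfl⟩ hne
    refine Set.disjoint_left.2 fun c hV hW => hne ?_
    rw [eq_of_mem_invariantPiece hV hW]
  sUnion_eq := by
    ext c
    constructor
    · rintro ⟨_, ⟨V, hV, rfl⟩, hc⟩
      exact ⟨V, hV, hc⟩
    · rintro ⟨V, hV, hc⟩
      exact ⟨_, ⟨V, hV, rfl⟩, hc⟩

lemma ncard_invariantPartition (m ℓ : ℕ) :
    (invariantPartition m ℓ).ncard = Nat.card (Subspaces m ℓ) := by
  have : invariantPartition m ℓ = Set.range fun V : Subspaces m ℓ => invariantPiece V.1 := by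
    ext S
    constructor
    · rintro ⟨V, hV, rfl⟩
      exact ⟨⟨V, hV⟩, rfl⟩
    · rintro ⟨V, rfl⟩
      exact ⟨V.1, V.2, rfl⟩
  rw [this, ← Nat.card_coe_set_eq]
  exact Nat.card_range_of_injective ((invariantPiece_injective m).comp Subtype.val_injective)

/-- A `V`-invariant function is an injective function on the quotient by `V`; constant functions
on the quotient are not of this kind, whence the strict inequality. -/
lemma card_invariantFunctions_lt {m : ℕ} (V : Submodule (ZMod 2) (Cube m))
    (h : Module.finrank (ZMod 2) V < m) :
    Nat.card {f : Cube m → Cube m // IsInvariantFunction V f} <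
      2 ^ (m * 2 ^ (m - Module.finrank (ZMod 2) V)) := by
  have hfr : Module.finrank (ZMod 2) (Cube m ⧸ V) = m - Module.finrank (ZMod 2) V := by
    have := Submodule.finrank_quotient_add_finrank V
    rw [Module.finrank_fin_fun] at this
    omega
  have hcard : Nat.card (Cube m ⧸ V) = 2 ^ (m - Module.finrank (ZMod 2) V) := by
    rw [Module.natCard_eq_pow_finrank (K := ZMod 2), hfr]
    simp
  have hfun : Nat.card ((Cube m ⧸ V) → Cube m) = 2 ^ (m * 2 ^ (m - Module.finrank (ZMod 2) V)) := by
    rw [Nat.card_fun, card_cube, hcard, pow_mul]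
  have hout : ∀ x : Cube m, x - (Submodule.Quotient.mk (p := V) x).out ∈ V := fun x => by
    rw [← Submodule.Quotient.eq]
    exact (Quotient.out_eq (s := V.quotientRel) _).symm
  have := Fintype.ofFinite {f : Cube m → Cube m // IsInvariantFunction V f}
  have := Fintype.ofFinite ((Cube m ⧸ V) → Cube m)
  rw [← hfun, Nat.card_eq_fintype_card, Nat.card_eq_fintype_card]
  refine Fintype.card_lt_of_injective_of_notMem
    (fun f => fun q : Cube m ⧸ V => f.1 q.out) ?_ (b := fun _ => 0) ?_
  · intro f g hfg
    apply Subtype.ext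
    funext x
    have hx := congrFun hfg (Submodule.Quotient.mk x)
    rw [(f.2.eq_iff_sub_mem _ _).2 (hout x), (g.2.eq_iff_sub_mem _ _).2 (hout x)]
    exact hx
  · rintro ⟨f, hf⟩
    have hsub : Subsingleton (Cube m ⧸ V) := by
      refine ⟨fun a b => ?_⟩
      have hab : f.1 a.out = f.1 b.out := (congrFun hf a).trans (congrFun hf b).symm
      rw [f.2.eq_iff_sub_mem, ← Submodule.Quotient.eq] at hab
      rw [← Quotient.out_eq (s := V.quotientRel) a, ← Quotient.out_eq (s := V.quotientRel) b]
      exact hab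
    have h1 : Nat.card (Cube m ⧸ V) = 1 := Nat.card_unique
    rw [hcard] at h1
    exact (Nat.one_lt_two_pow (by omega)).ne' h1

lemma ncard_invariantClass_lt {m ℓ : ℕ} (h1 : 1 ≤ ℓ) (h2 : ℓ < m) :
    (invariantClass m ℓ).ncard < 2 ^ (m * ℓ - ℓ ^ 2 + ℓ + m * 2 ^ (m - ℓ)) := by
  classical
  have := Fintype.ofFinite (Subspaces m ℓ)
  let F : (Σ V : Subspaces m ℓ, {f : Cube m → Cube m // IsInvariantFunction V.1 f}) →
      invariantClass m ℓ := fun p => ⟨bitConcept p.2.1, p.1.1, p.1.2, p.2.1, p.2.2, rfl⟩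
  have hF : F.Surjective := by
    rintro ⟨_, V, hV, f, hf, rfl⟩
    exact ⟨⟨⟨V, hV⟩, ⟨f, hf⟩⟩, rfl⟩
  have hcard := Nat.card_le_card_of_surjective F hF
  rw [Nat.card_coe_set_eq, Nat.card_sigma] at hcard
  have hne : Nonempty (Subspaces m ℓ) := by
    by_contra hcon
    rw [not_nonempty_iff] at hcon
    have := two_le_card_subspaces h1 h2
    simp at this
  calc _ ≤ _ := hcard
    _ < ∑ _V : Subspaces m ℓ, 2 ^ (m * 2 ^ (m - ℓ)) := by
        refine Finset.sum_lt_sum_of_nonempty Finset.univ_nonempty fun V _ => ?_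
        have := card_invariantFunctions_lt V.1 (by rw [V.2]; exact h2)
        rwa [V.2] at this
    _ = Nat.card (Subspaces m ℓ) * 2 ^ (m * 2 ^ (m - ℓ)) := by
        rw [Finset.sum_const, Finset.card_univ, Nat.card_eq_fintype_card, smul_eq_mul]
    _ ≤ _ := by
        rw [pow_add]
        exact Nat.mul_le_mul_right _ (card_subspaces_le h2.le)

lemma lt_ncard_invariantPartition {m ℓ : ℕ} (h1 : 1 ≤ ℓ) (h2 : ℓ < m) :
    2 ^ (m * ℓ - ℓ ^ 2 - ℓ) < (invariantPartition m ℓ).ncard := by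
  rw [ncard_invariantPartition]
  refine lt_of_lt_of_le (Nat.pow_lt_pow_right (by norm_num) ?_) (le_card_subspaces h2.le)
  rw [Nat.sub_mul, ← sq]
  refine Nat.sub_lt (Nat.sub_pos_of_lt ?_) h1
  rw [sq]
  exact Nat.mul_lt_mul_of_pos_right h2 h1

/-! ### Query trees and their queries -/

/-- Every function of the concept is computed by some query tree, as long as it depends only on
finitely many values of the concept. -/
lemma exists_queryTree_run_eq {n : ℕ} {O : Type} (L : List (Cube n)) :
    ∀ out : BoolConcept n → O, (∀ c c', (∀ x ∈ L, c x = c' x) → out c = out c') →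
      ∃ t : QueryTree n O, ∀ c, t.run c = out c := by
  induction L with
  | nil =>
    intro out h
    exact ⟨.answer (out 0), fun c => h _ _ (by simp)⟩
  | cons x L ih =>
    intro out h
    have key : ∀ b : ZMod 2, ∃ t : QueryTree n O, ∀ c, t.run c = out (Function.update c x b) := by
      intro b
      refine ih (fun c => out (Function.update c x b)) fun c c' hc => h _ _ fun y hy => ?_
      by_cases hyx : y = x
      · simp [hyx]
      · rw [Function.update_of_ne hyx, Function.update_of_ne hyx]
        exact hc y ((List.mem_cons.1 hy).resolve_left hyx)
    obtain ⟨t₀, h₀⟩ := key 0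
    obtain ⟨t₁, h₁⟩ := key 1
    refine ⟨.query x t₀ t₁, fun c => ?_⟩
    by_cases hc : c x = 0
    · simp only [QueryTree.run, hc, if_true, h₀]
      rw [← hc, Function.update_eq_self]
    · have hc' : c x = 1 := by
        generalize c x = b at hc
        revert b
        decide
      simp only [QueryTree.run, hc, if_false, h₁]
      rw [← hc', Function.update_eq_self]

lemma exists_classicallyLearnable {n : ℕ} {C : Set (BoolConcept n)} {P : Set (Set (BoolConcept n))}
    (h : IsConceptPartition C P) : ∃ T, ClassicallyLearnable C P T := by
  classical
  let out : BoolConcept n → Set (BoolConcept n) := fun c =>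
    if hc : ∃ S, CorrectPiece P c S then hc.choose else ∅
  obtain ⟨t, ht⟩ := exists_queryTree_run_eq (Finset.univ : Finset (Cube n)).toList out (by
    intro c c' hcc
    rw [funext fun x => hcc x (by simp)])
  refine ⟨t.depth, PMF.pure t, ?_, fun c hc => ?_⟩
  · intro t' ht'
    rw [PMF.support_pure, Set.mem_singleton_iff] at ht'
    rw [ht']
  · have hex : ∃ S, CorrectPiece P c S := by
      rw [← h.sUnion_eq] at hc
      exact hc
    rw [PMF.toOuterMeasure_pure_apply, if_pos]
    · exact ENNReal.div_le_of_le_mul (by norm_num)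
    · show CorrectPiece P c (t.run c)
      rw [ht]
      simp only [out, dif_pos hex]
      exact hex.choose_spec

/-- The points of `{0,1}^m` at which the values of the unknown function are queried. -/
noncomputable def QueryTree.points {m : ℕ} {O : Type} (c : BoolConcept (inputLength m)) :
    QueryTree (inputLength m) O → Finset (Cube m)
  | .answer _ => ∅
  | .query x t₀ t₁ => insert (inputPoint x) (if c x = 0 then t₀.points c else t₁.points c)

lemma QueryTree.card_points_le {m : ℕ} {O : Type} (c : BoolConcept (inputLength m))
    (t : QueryTree (inputLength m) O) : (t.points c).card ≤ t.depth := by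
  induction t with
  | answer o => simp [points]
  | query x t₀ t₁ h₀ h₁ =>
    refine (Finset.card_insert_le _ _).trans ?_
    rw [depth]
    split_ifs <;> omega

/-- The event that the oracle `c` agrees with the list `K` of past answers, that `g` separates all
the points queried in `K` and in the run of `t`, and that the answer of `t` satisfies `good`. -/
def SeparatedRun {m : ℕ} {O : Type} (g : Cube m → Cube m) (good : O → Prop)
    (K : List (Cube (inputLength m) × ZMod 2)) (t : QueryTree (inputLength m) O)
    (c : BoolConcept (inputLength m)) : Prop :=
  (∀ p ∈ K, c p.1 = p.2) ∧ Set.InjOn g ({x | ∃ p ∈ K, inputPoint p.1 = x} ∪ t.points c) ∧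
    good (t.run c)

lemma separatedRun_query {m : ℕ} {O : Type} (g : Cube m → Cube m) (good : O → Prop)
    (K : List (Cube (inputLength m) × ZMod 2)) (x : Cube (inputLength m))
    (t₀ t₁ : QueryTree (inputLength m) O) (c : BoolConcept (inputLength m)) :
    SeparatedRun g good K (.query x t₀ t₁) c ↔
      SeparatedRun g good ((x, 0) :: K) t₀ c ∨ SeparatedRun g good ((x, 1) :: K) t₁ c := by
  have hset : ∀ (b : ZMod 2) (X : Finset (Cube m)),
      ({y | ∃ p ∈ K, inputPoint p.1 = y} ∪ ((insert (inputPoint x) X : Finset (Cube m)) : Set _)) =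
      ({y | ∃ p ∈ (x, b) :: K, inputPoint p.1 = y} ∪ (X : Set (Cube m))) := by
    intro b X
    ext y
    simp only [Set.mem_union, Set.mem_ofPred_eq, Finset.coe_insert, Set.mem_insert_iff,
      List.mem_cons, exists_eq_or_imp, eq_comm (a := y)]
    rw [or_left_comm, or_assoc]
  by_cases hc : c x = 0
  · have h1 : ¬ SeparatedRun g good ((x, 1) :: K) t₁ c := fun h => by
      have := h.1 (x, 1) (by simp)
      rw [hc] at this
      exact zero_ne_one this
    rw [or_iff_left h1]
    simp only [SeparatedRun, QueryTree.points, QueryTree.run, hc, if_true, hset 0,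
      List.forall_mem_cons, true_and]
  · have hc' : c x = 1 := by
      generalize c x = b at hc
      revert b
      decide
    have h1 : ¬ SeparatedRun g good ((x, 0) :: K) t₀ c := fun h => hc (h.1 (x, 0) (by simp))
    rw [or_iff_right h1]
    simp only [SeparatedRun, QueryTree.points, QueryTree.run, hc, if_false, hset 1,
      List.forall_mem_cons]
    simp [hc']

open Classical in
/-- The hiding lemma: for a uniformly random permutation `σ`, a query algorithm cannot tell `σ ∘ g`
from `σ` as long as it has not queried two points with the same image under `g`. The reason is
that `g` agrees on the queried points with some permutation `τ`, and `σ ∘ τ` is again uniform. -/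
lemma card_separatedRun_comp {m : ℕ} {O : Type} (g : Cube m → Cube m) (good : O → Prop)
    (t : QueryTree (inputLength m) O) : ∀ K : List (Cube (inputLength m) × ZMod 2),
    (Finset.univ.filter fun σ : Equiv.Perm (Cube m) =>
      SeparatedRun g good K t (bitConcept (σ ∘ g))).card =
    (Finset.univ.filter fun σ : Equiv.Perm (Cube m) =>
      SeparatedRun g good K t (bitConcept σ)).card := by
  induction t with
  | answer o =>
    intro K
    by_cases hg : Set.InjOn g {x | ∃ p ∈ K, inputPoint p.1 = x}
    · obtain ⟨τ, hτ⟩ := Equiv.Perm.exists_extending_pair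
        (fun x : {x | ∃ p ∈ K, inputPoint p.1 = x} => (x : Cube m)) (fun x => g x)
        Subtype.val_injective hg.injective
      refine Finset.card_equiv (Equiv.mulRight τ) fun σ => ?_
      rw [Finset.mem_filter, Finset.mem_filter]
      simp only [Finset.mem_univ, true_and, SeparatedRun, QueryTree.points, QueryTree.run]
      refine and_congr_left fun _ => forall₂_congr fun p hp => ?_
      have := hτ ⟨inputPoint p.1, p, hp, rfl⟩
      simp only at this
      simp [bitConcept, this]
    · rw [Finset.filter_false_of_mem, Finset.filter_false_of_mem] <;>
      · rintro σ - ⟨-, h, -⟩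
        exact hg (by simpa [QueryTree.points] using h)
  | query x t₀ t₁ h₀ h₁ =>
    intro K
    have hdisj : ∀ h : Equiv.Perm (Cube m) → BoolConcept (inputLength m),
        Disjoint (Finset.univ.filter fun σ => SeparatedRun g good ((x, 0) :: K) t₀ (h σ))
          (Finset.univ.filter fun σ => SeparatedRun g good ((x, 1) :: K) t₁ (h σ)) := by
      refine fun h => Finset.disjoint_filter.2 fun σ _ hl hr => ?_
      have e0 := hl.1 (x, 0) (by simp)
      have e1 := hr.1 (x, 1) (by simp)
      exact zero_ne_one (e0.symm.trans e1)
    simp only [separatedRun_query, Finset.filter_or]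
    rw [Finset.card_union_of_disjoint (hdisj fun σ => bitConcept (σ ∘ g)),
      Finset.card_union_of_disjoint (hdisj fun σ => bitConcept σ), h₀, h₁]

open Classical in
/-- A single algorithm succeeds on `σ ∘ g` at most as often as it gives the same answer on `σ`,
up to the probability that it queries on `σ` two points with the same image under `g`. -/
lemma card_run_comp_le {m : ℕ} {O : Type} (g : Cube m → Cube m) (good : O → Prop)
    (t : QueryTree (inputLength m) O) :
    (Finset.univ.filter fun σ : Equiv.Perm (Cube m) =>
      good (t.run (bitConcept (σ ∘ g)))).card ≤
    (Finset.univ.filter fun σ : Equiv.Perm (Cube m) => good (t.run (bitConcept σ))).card +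
    (Finset.univ.filter fun σ : Equiv.Perm (Cube m) =>
      ¬ Set.InjOn g (t.points (bitConcept σ))).card := by
  have hsep : ∀ (Q : O → Prop) (c : BoolConcept (inputLength m)),
      SeparatedRun g Q [] t c ↔ Set.InjOn g (t.points c) ∧ Q (t.run c) := by
    intro Q c
    simp [SeparatedRun]
  have h1 := card_separatedRun_comp g good t []
  have h2 := card_separatedRun_comp g (fun _ => True) t []
  simp only [hsep, and_true] at h1 h2
  have h3 := Finset.card_filter_add_card_filter_not (s := Finset.univ)
    fun σ : Equiv.Perm (Cube m) => Set.InjOn g (t.points (bitConcept (σ ∘ g)))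
  have h4 := Finset.card_filter_add_card_filter_not (s := Finset.univ)
    fun σ : Equiv.Perm (Cube m) => Set.InjOn g (t.points (bitConcept σ))
  have h5 : (Finset.univ.filter fun σ : Equiv.Perm (Cube m) =>
      Set.InjOn g (t.points (bitConcept σ)) ∧ good (t.run (bitConcept σ))).card ≤
      (Finset.univ.filter fun σ : Equiv.Perm (Cube m) => good (t.run (bitConcept σ))).card :=
    Finset.card_le_card (Finset.monotone_filter_right _ fun σ _ h => h.2)
  have h6 : (Finset.univ.filter fun σ : Equiv.Perm (Cube m) =>
      good (t.run (bitConcept (σ ∘ g)))).card ≤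
      (Finset.univ.filter fun σ : Equiv.Perm (Cube m) =>
        Set.InjOn g (t.points (bitConcept (σ ∘ g))) ∧ good (t.run (bitConcept (σ ∘ g)))).card +
      (Finset.univ.filter fun σ : Equiv.Perm (Cube m) =>
        ¬ Set.InjOn g (t.points (bitConcept (σ ∘ g)))).card := by
    refine (Finset.card_le_card fun σ hσ => ?_).trans (Finset.card_union_le _ _)
    simp only [Finset.mem_union, Finset.mem_filter, Finset.mem_univ, true_and] at hσ ⊢
    tauto
  omega

/-! ### Random subspaces and the classical lower bound -/

lemma exists_linearEquiv_apply_eq {m : ℕ} {v w : Cube m} (hv : v ≠ 0) (hw : w ≠ 0) :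
    ∃ e : Cube m ≃ₗ[ZMod 2] Cube m, e v = w := by
  obtain ⟨e, he⟩ := Submodule.exists_linearEquiv_restrict_eq
    ((LinearEquiv.toSpanNonzeroSingleton (ZMod 2) (Cube m) v hv).symm ≪≫ₗ
      LinearEquiv.toSpanNonzeroSingleton (ZMod 2) (Cube m) w hw)
  refine ⟨e, ?_⟩
  have := he ⟨v, Submodule.mem_span_singleton_self v⟩
  rw [← this]
  have h1 : (LinearEquiv.toSpanNonzeroSingleton (ZMod 2) (Cube m) v hv).symm
      ⟨v, Submodule.mem_span_singleton_self v⟩ = 1 := by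
    rw [LinearEquiv.symm_apply_eq, LinearEquiv.toSpanNonzeroSingleton_one]
  rw [LinearEquiv.trans_apply, h1, LinearEquiv.toSpanNonzeroSingleton_one]

lemma card_subspaces_mem_eq {m ℓ : ℕ} {v w : Cube m} (hv : v ≠ 0) (hw : w ≠ 0) :
    Nat.card {V : Subspaces m ℓ // v ∈ V.1} = Nat.card {V : Subspaces m ℓ // w ∈ V.1} := by
  have key : ∀ {v w : Cube m}, v ≠ 0 → w ≠ 0 →
      Nat.card {V : Subspaces m ℓ // v ∈ V.1} ≤ Nat.card {V : Subspaces m ℓ // w ∈ V.1} := by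
    intro v w hv hw
    obtain ⟨e, rfl⟩ := exists_linearEquiv_apply_eq hv hw
    refine Nat.card_le_card_of_injective (fun V => ⟨⟨V.1.1.map e.toLinearMap, ?_⟩, ?_⟩) ?_
    · rw [LinearEquiv.finrank_map_eq, V.1.2]
    · exact Submodule.mem_map_of_mem V.2
    · intro V W h
      apply Subtype.ext
      apply Subtype.ext
      exact Submodule.map_injective_of_injective e.injective
        (congrArg (fun U => U.1.1) h)
  exact le_antisymm (key hv hw) (key hw hv)

/-- A nonzero vector lies in at most a fraction `2^ℓ / 2^m` of the `ℓ`-dimensional subspaces. -/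
lemma card_subspaces_mem_mul_le {m ℓ : ℕ} {v : Cube m} (hv : v ≠ 0) :
    Nat.card {V : Subspaces m ℓ // v ∈ V.1} * 2 ^ m ≤ Nat.card (Subspaces m ℓ) * 2 ^ ℓ := by
  classical
  have := Fintype.ofFinite (Subspaces m ℓ)
  have hcount : ∑ w : Cube m, Nat.card {V : Subspaces m ℓ // w ∈ V.1} =
      Nat.card (Subspaces m ℓ) * 2 ^ ℓ := by
    have e : (Σ w : Cube m, {V : Subspaces m ℓ // w ∈ V.1}) ≃ (Σ V : Subspaces m ℓ, V.1) :=
      { toFun := fun p => ⟨p.2.1, p.1, p.2.2⟩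
        invFun := fun p => ⟨p.2.1, p.1, p.2.2⟩
        left_inv := fun _ => rfl
        right_inv := fun _ => rfl }
    have h := Nat.card_congr e
    rw [Nat.card_sigma, Nat.card_sigma] at h
    rw [h, Finset.sum_congr rfl fun V _ => (card_submodule V.1).trans (by rw [V.2]),
      Finset.sum_const, Finset.card_univ, Nat.card_eq_fintype_card, smul_eq_mul]
  have hle : ∀ w : Cube m, Nat.card {V : Subspaces m ℓ // v ∈ V.1} ≤
      Nat.card {V : Subspaces m ℓ // w ∈ V.1} := by
    intro w
    by_cases hw : w = 0
    · subst hw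
      exact Nat.card_le_card_of_injective (fun V => ⟨V.1, V.1.1.zero_mem⟩)
        fun V W h => Subtype.ext (congrArg (fun U => U.1) h)
    · exact (card_subspaces_mem_eq hv hw).le
  rw [← hcount, mul_comm, ← card_cube m, Nat.card_eq_fintype_card, ← smul_eq_mul, ← Finset.card_univ]
  exact Finset.card_nsmul_le_sum _ _ _ fun w _ => hle w

/-- Averaging over the random choices of an algorithm: if every deterministic algorithm in the
support succeeds on at most `B` of the inputs, the success probabilities sum to at most `B`. -/
lemma PMF.sum_toOuterMeasure_le {α ι : Type*} [Fintype ι] (A : PMF α) (S : ι → Set α) (B : ℕ)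
    (h : ∀ t ∈ A.support, Nat.card {i // t ∈ S i} ≤ B) :
    ∑ i, A.toOuterMeasure (S i) ≤ B := by
  classical
  simp only [PMF.toOuterMeasure_apply]
  rw [← Summable.tsum_finsetSum fun i _ => ENNReal.summable]
  calc ∑' t, ∑ i, (S i).indicator A t ≤ ∑' t, A t * B := by
        refine ENNReal.tsum_le_tsum fun t => ?_
        by_cases ht : t ∈ A.support
        · simp only [Set.indicator_apply]
          rw [← Finset.sum_filter, Finset.sum_const, nsmul_eq_mul, mul_comm]
          gcongr
          rw [← Fintype.card_subtype, ← Nat.card_eq_fintype_card]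
          exact h t ht
        · have : A t = 0 := by simpa [PMF.mem_support_iff] using ht
          simp [this]
    _ = B := by rw [ENNReal.tsum_mul_right, A.tsum_coe, one_mul]

open Classical in
/-- On average over a random subspace `V` and a random permutation `σ`, a deterministic algorithm
making at most `T` queries rarely finds `V` when the oracle is `σ ∘ g V`. -/
lemma card_correct_mul_le {m ℓ T : ℕ} (g : Subspaces m ℓ → Cube m →ₗ[ZMod 2] Cube m)
    (hg : ∀ V, LinearMap.ker (g V) = V.1)
    (t : QueryTree (inputLength m) (Set (BoolConcept (inputLength m)))) (ht : t.depth ≤ T) :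
    Nat.card {p : Subspaces m ℓ × Equiv.Perm (Cube m) //
        t.run (bitConcept (p.2 ∘ g p.1)) = invariantPiece p.1.1} * 2 ^ m ≤
      Nat.card (Equiv.Perm (Cube m)) * (2 ^ m + T ^ 2 * (Nat.card (Subspaces m ℓ) * 2 ^ ℓ)) := by
  have := Fintype.ofFinite (Subspaces m ℓ)
  have hsplit : Nat.card {p : Subspaces m ℓ × Equiv.Perm (Cube m) //
        t.run (bitConcept (p.2 ∘ g p.1)) = invariantPiece p.1.1} =
      ∑ V : Subspaces m ℓ, (Finset.univ.filter fun σ : Equiv.Perm (Cube m) =>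
        t.run (bitConcept (σ ∘ g V)) = invariantPiece V.1).card := by
    rw [Nat.card_eq_fintype_card, Fintype.card_subtype, Finset.card_filter,
      Fintype.sum_prod_type]
    simp only [Finset.card_filter]
  have hright : ∑ V : Subspaces m ℓ, (Finset.univ.filter fun σ : Equiv.Perm (Cube m) =>
        t.run (bitConcept σ) = invariantPiece V.1).card ≤ Nat.card (Equiv.Perm (Cube m)) := by
    simp only [Finset.card_filter]
    rw [Finset.sum_comm, Nat.card_eq_fintype_card, ← Finset.card_univ, Finset.card_eq_sum_ones]
    refine Finset.sum_le_sum fun σ _ => ?_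
    rw [← Finset.card_filter, Finset.card_le_one]
    intro V hV W hW
    rw [Finset.mem_filter] at hV hW
    exact Subtype.ext (invariantPiece_injective m (hV.2.symm.trans hW.2))
  have hcoll : (∑ V : Subspaces m ℓ, (Finset.univ.filter fun σ : Equiv.Perm (Cube m) =>
        ¬ Set.InjOn (g V) (t.points (bitConcept σ))).card) * 2 ^ m ≤
      Nat.card (Equiv.Perm (Cube m)) * (T ^ 2 * (Nat.card (Subspaces m ℓ) * 2 ^ ℓ)) := by
    simp only [Finset.card_filter]
    rw [Finset.sum_comm, Nat.card_eq_fintype_card, ← Finset.card_univ,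
      ← smul_eq_mul (a := Finset.card _), ← Finset.sum_const, Finset.sum_mul]
    refine Finset.sum_le_sum fun σ _ => ?_
    rw [← Finset.card_filter]
    set X := t.points (bitConcept σ) with hX
    -- a collision modulo `V` is a pair of queried points whose nonzero difference lies in `V`
    have hsub : (Finset.univ.filter fun V : Subspaces m ℓ => ¬ Set.InjOn (g V) X) ⊆
        X.offDiag.biUnion fun p => Finset.univ.filter fun V : Subspaces m ℓ => p.1 - p.2 ∈ V.1 := by
      intro V hV
      simp only [Finset.mem_filter, Finset.mem_univ, true_and, Set.InjOn, not_forall] at hV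
      obtain ⟨x, hx, y, hy, hxy, hne⟩ := hV
      simp only [Finset.mem_biUnion, Finset.mem_filter, Finset.mem_univ, true_and,
        Finset.mem_offDiag]
      refine ⟨(x, y), ⟨hx, hy, hne⟩, ?_⟩
      rw [← hg V, LinearMap.mem_ker, map_sub, hxy, sub_self]
    calc _ ≤ (∑ p ∈ X.offDiag,
            (Finset.univ.filter fun V : Subspaces m ℓ => p.1 - p.2 ∈ V.1).card) * 2 ^ m :=
          Nat.mul_le_mul_right _ ((Finset.card_le_card hsub).trans Finset.card_biUnion_le)
      _ ≤ ∑ p ∈ X.offDiag, Nat.card (Subspaces m ℓ) * 2 ^ ℓ := by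
          rw [Finset.sum_mul]
          refine Finset.sum_le_sum fun p hp => ?_
          rw [← Fintype.card_subtype, ← Nat.card_eq_fintype_card]
          exact card_subspaces_mem_mul_le (sub_ne_zero.2 (Finset.mem_offDiag.1 hp).2.2)
      _ ≤ _ := by
          rw [Finset.sum_const, smul_eq_mul]
          refine Nat.mul_le_mul_right _ ?_
          rw [Finset.offDiag_card, sq]
          have hXT : X.card ≤ T := (t.card_points_le _).trans ht
          exact (Nat.sub_le _ _).trans (Nat.mul_le_mul hXT hXT)
  rw [hsplit, mul_add]
  refine le_trans ?_ (add_le_add (Nat.mul_le_mul_right (2 ^ m) hright) hcoll)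
  rw [← add_mul, ← Finset.sum_add_distrib]
  exact Nat.mul_le_mul_right _ (Finset.sum_le_sum fun V _ =>
    card_run_comp_le (g V) (fun S => S = invariantPiece V.1) t)

lemma two_pow_le_of_classicallyLearnable {m ℓ T : ℕ} (h1 : 1 ≤ ℓ) (h2 : ℓ < m)
    (h : ClassicallyLearnable (invariantClass m ℓ) (invariantPartition m ℓ) T) :
    2 ^ (m - ℓ) ≤ 6 * T ^ 2 := by
  classical
  obtain ⟨A, hdepth, hA⟩ := h
  have := Fintype.ofFinite (Subspaces m ℓ)
  choose g hg using fun V : Subspaces m ℓ => exists_linearMap_ker_eq V.1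
  set s := Nat.card (Subspaces m ℓ) with hs
  set N := Nat.card (Equiv.Perm (Cube m)) with hN
  have hNpos : 0 < N := Nat.card_pos
  let c : Subspaces m ℓ × Equiv.Perm (Cube m) → BoolConcept (inputLength m) :=
    fun p => bitConcept (p.2 ∘ g p.1)
  have hpiece : ∀ p, c p ∈ invariantPiece p.1.1 := fun p =>
    ⟨_, hg p.1 ▸ isInvariantFunction_perm_comp p.2 (g p.1), rfl⟩
  set B := N * (2 ^ m + T ^ 2 * (s * 2 ^ ℓ)) with hB
  have hsum := PMF.sum_toOuterMeasure_le A
    (fun p => {t | CorrectPiece (invariantPartition m ℓ) (c p) (t.run (c p))}) (B / 2 ^ m) (by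
      intro t ht
      rw [Nat.le_div_iff_mul_le (by positivity)]
      refine le_trans (Nat.mul_le_mul_right _ ?_) (card_correct_mul_le g hg t (hdepth t ht))
      refine Nat.card_le_card_of_injective (fun p => ⟨p.1, ?_⟩)
        fun p q hpq => Subtype.ext (congrArg (fun r => r.1) hpq)
      obtain ⟨⟨W, -, hW⟩, hmem⟩ := p.2
      rw [hW] at hmem
      exact hW.trans (congrArg _ (eq_of_mem_invariantPiece hmem (hpiece p.1))))
  have hlow : ((s * N : ℕ) : ℝ≥0∞) * (2 / 3) ≤ ((B / 2 ^ m : ℕ) : ℝ≥0∞) := by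
    refine le_trans ?_ hsum
    have := Finset.card_nsmul_le_sum Finset.univ
      (fun p => A.toOuterMeasure {t | CorrectPiece (invariantPartition m ℓ) (c p) (t.run (c p))})
      (2 / 3) fun p _ => hA (c p) ⟨p.1.1, p.1.2, hpiece p⟩
    rwa [Finset.card_univ, ← Nat.card_eq_fintype_card, Nat.card_prod, nsmul_eq_mul] at this
  have hnat : s * N * 2 ≤ (B / 2 ^ m) * 3 := by
    have h3 : ((s * N : ℕ) : ℝ≥0∞) * (2 / 3) * 3 ≤ ((B / 2 ^ m : ℕ) : ℝ≥0∞) * 3 :=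
      mul_le_mul_left hlow 3
    rw [mul_assoc, ENNReal.div_mul_cancel (by norm_num) (by norm_num)] at h3
    exact_mod_cast h3
  have hmul : s * N * 2 * 2 ^ m ≤ B * 3 := by
    calc s * N * 2 * 2 ^ m ≤ (B / 2 ^ m) * 3 * 2 ^ m := Nat.mul_le_mul_right _ hnat
      _ = (B / 2 ^ m) * 2 ^ m * 3 := by ring
      _ ≤ _ := Nat.mul_le_mul_right _ (Nat.div_mul_le_self _ _)
  have hs2 : 2 ≤ s := two_le_card_subspaces h1 h2
  have hcancel : s * 2 * 2 ^ m ≤ (2 ^ m + T ^ 2 * (s * 2 ^ ℓ)) * 3 := by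
    refine Nat.le_of_mul_le_mul_left ?_ hNpos
    calc N * (s * 2 * 2 ^ m) = s * N * 2 * 2 ^ m := by ring
      _ ≤ B * 3 := hmul
      _ = _ := by rw [hB]; ring
  have hpow : 2 ^ m = 2 ^ (m - ℓ) * 2 ^ ℓ := by rw [← pow_add, Nat.sub_add_cancel h2.le]
  -- as `s ≥ 2`, guessing accounts for success probability `1/2` at most, and `2/3 - 1/2 = 1/6`
  have hfin : s * 2 ^ ℓ * 2 ^ (m - ℓ) ≤ s * 2 ^ ℓ * (6 * T ^ 2) := by
    have h4 : 2 * 2 ^ m ≤ s * 2 ^ m := Nat.mul_le_mul_right _ hs2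
    have h5 : s * 2 ^ ℓ * 2 ^ (m - ℓ) = s * 2 ^ m := by rw [hpow]; ring
    rw [h5]
    nlinarith
  exact Nat.le_of_mul_le_mul_left hfin (by positivity)

/-- The classical lower bound: `T` queries reveal a collision with probability at most
`T² 2^ℓ / 2^m`, so that `T` has to be of the order of `2^((m - ℓ)/2)`. -/
lemma rpow_le_classicalComplexity {m ℓ : ℕ} (h1 : 1 ≤ ℓ) (h2 : ℓ < m) :
    (1 / 3 : ℝ) * (2 : ℝ) ^ (((m : ℝ) - (ℓ : ℝ)) / 3) ≤
      (classicalComplexity (invariantClass m ℓ) (invariantPartition m ℓ) : ℝ) := by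
  set T := classicalComplexity (invariantClass m ℓ) (invariantPartition m ℓ) with hT
  have hmem : ClassicallyLearnable (invariantClass m ℓ) (invariantPartition m ℓ) T :=
    Nat.sInf_mem (exists_classicallyLearnable (isConceptPartition_invariant m ℓ))
  have hT2 : (2 : ℝ) ^ (m - ℓ) ≤ 6 * (T : ℝ) ^ 2 := by
    exact_mod_cast two_pow_le_of_classicallyLearnable h1 h2 hmem
  have hsq : ((2 : ℝ) ^ (((m : ℝ) - (ℓ : ℝ)) / 3)) ^ 2 ≤ (2 : ℝ) ^ (m - ℓ) := by
    have hml : (ℓ : ℝ) < m := by exact_mod_cast h2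
    rw [← Real.rpow_natCast, ← Real.rpow_natCast, ← Real.rpow_mul (by norm_num)]
    refine Real.rpow_le_rpow_of_exponent_le (by norm_num) ?_
    rw [Nat.cast_sub h2.le]
    push_cast
    linarith
  refine le_of_sq_le_sq ?_ (Nat.cast_nonneg T)
  nlinarith [sq_nonneg (T : ℝ)]

/-! ### Quantum algorithms making parallel queries -/

lemma Cube.add_self {n : ℕ} (q : Cube n) : q + q = 0 := by
  funext i
  exact CharTwo.add_self_eq_zero (q i)

lemma quantumOracle_single {n d : ℕ} (c : BoolConcept n) (q : Cube n) (b : ZMod 2) (w : Fin d) :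
    quantumOracle c (Pi.single (q, b, w) 1 : QBasis n d → ℂ) = Pi.single (q, b + c q, w) 1 := by
  funext z
  obtain ⟨q', b', w'⟩ := z
  simp only [quantumOracle, Pi.single_apply, Prod.mk.injEq]
  refine if_congr (and_congr_right fun hq => and_congr_left fun _ => ?_) rfl rfl
  subst hq
  rw [← sub_eq_iff_eq_add, CharTwo.sub_eq_add]

lemma quantumOracle_sum_smul {n d : ℕ} {X : Type*} [Fintype X] (c : BoolConcept n) (a : X → ℂ)
    (v : X → QBasis n d → ℂ) :
    quantumOracle c (∑ x, a x • v x) = ∑ x, a x • quantumOracle c (v x) := by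
  funext z
  simp [quantumOracle]

lemma mulVec_sum_smul {B X : Type*} [Fintype B] [Fintype X] (M : Matrix B B ℂ) (a : X → ℂ)
    (v : X → B → ℂ) : M.mulVec (∑ x, a x • v x) = ∑ x, a x • M.mulVec (v x) := by
  rw [Matrix.mulVec_sum]
  simp only [Matrix.mulVec_smul]

/-- The unitary that permutes the basis states by `σ`. -/
def permUnitary {B : Type*} [Fintype B] [DecidableEq B] (σ : Equiv.Perm B) :
    Matrix.unitaryGroup B ℂ :=
  ⟨(σ⁻¹).permMatrix ℂ, by
    rw [Matrix.mem_unitaryGroup_iff, Matrix.star_eq_conjTranspose, Matrix.conjTranspose_permMatrix,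
      ← Matrix.permMatrix_mul]
    simp⟩

lemma permUnitary_mulVec_single {B : Type*} [Fintype B] [DecidableEq B] (σ : Equiv.Perm B) (a : B) :
    (permUnitary σ : Matrix B B ℂ).mulVec (Pi.single a 1) = Pi.single (σ a) 1 := by
  rw [permUnitary, Matrix.permMatrix_mulVec]
  funext b
  simp only [Function.comp_apply, Pi.single_apply, Equiv.Perm.inv_eq_iff_eq]

/-- The unitary `H` applied to one register: `E` splits a basis state into this register and
the rest. -/
def registerUnitary {B R X : Type*} [Fintype B] [DecidableEq B] [Fintype R] [DecidableEq R]
    [Fintype X] [DecidableEq X] (E : B ≃ R × X) (H : Matrix.unitaryGroup X ℂ) :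
    Matrix.unitaryGroup B ℂ :=
  ⟨(Matrix.kroneckerMap (· * ·) (1 : Matrix R R ℂ) (H : Matrix X X ℂ)).submatrix E E, by
    have h := Matrix.kronecker_mem_unitary (one_mem (unitary (Matrix R R ℂ))) H.2
    rw [← Matrix.unitaryGroup, Matrix.mem_unitaryGroup_iff, Matrix.star_eq_conjTranspose] at h
    rw [Matrix.mem_unitaryGroup_iff, Matrix.star_eq_conjTranspose, Matrix.conjTranspose_submatrix,
      Matrix.submatrix_mul_equiv, h, Matrix.submatrix_one_equiv]⟩

lemma registerUnitary_apply {B R X : Type*} [Fintype B] [DecidableEq B] [Fintype R] [DecidableEq R]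
    [Fintype X] [DecidableEq X] (E : B ≃ R × X) (H : Matrix.unitaryGroup X ℂ) (r r' : R)
    (x x' : X) :
    (registerUnitary E H : Matrix B B ℂ) (E.symm (r, x)) (E.symm (r', x')) =
      if r = r' then (H : Matrix X X ℂ) x x' else 0 := by
  simp [registerUnitary, Matrix.one_apply]

lemma registerUnitary_mulVec_single {B R X : Type*} [Fintype B] [DecidableEq B] [Fintype R]
    [DecidableEq R] [Fintype X] [DecidableEq X] (E : B ≃ R × X) (H : Matrix.unitaryGroup X ℂ)
    (r : R) (x : X) :
    (registerUnitary E H : Matrix B B ℂ).mulVec (Pi.single (E.symm (r, x)) 1) =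
      ∑ y, (H : Matrix X X ℂ) y x • Pi.single (E.symm (r, y)) 1 := by
  funext b
  obtain ⟨⟨r', y⟩, rfl⟩ := E.symm.surjective b
  rw [Matrix.mulVec_single_one, Matrix.col_apply, registerUnitary_apply, Finset.sum_apply]
  simp only [Pi.smul_apply, Pi.single_apply, EmbeddingLike.apply_eq_iff_eq, Prod.mk.injEq,
    smul_eq_mul, mul_ite, mul_one, mul_zero]
  by_cases h : r' = r
  · simp [h]
  · simp [h]

/-- The basis of the parallel algorithm without the register `X` that is in superposition: query
register, answer bit, and one memory cell for each of the `T` answers. -/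
abbrev MemoryBasis (n T : ℕ) : Type := Cube n × ZMod 2 × (Fin T → ZMod 2)

/-- Add `δ x` to the query register, where `x` is the content of the register `X`. -/
def shiftPerm {n T : ℕ} {X : Type} (δ : X → Cube n) : Equiv.Perm (MemoryBasis n T × X) :=
  Function.Involutive.toPerm (fun p => ((p.1.1 + δ p.2, p.1.2), p.2)) fun p => by
    simp [add_assoc, Cube.add_self]

/-- Exchange the answer bit and the memory cell `i`. -/
def swapPerm {n T : ℕ} {X : Type} (i : Fin T) : Equiv.Perm (MemoryBasis n T × X) :=
  Function.Involutive.toPerm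
    (fun p => ((p.1.1, p.1.2.2 i, Function.update p.1.2.2 i p.1.2.1), p.2)) fun p => by simp

@[simp] lemma shiftPerm_apply {n T : ℕ} {X : Type} (δ : X → Cube n) (p : MemoryBasis n T × X) :
    shiftPerm δ p = ((p.1.1 + δ p.2, p.1.2), p.2) := rfl

@[simp] lemma swapPerm_apply {n T : ℕ} {X : Type} (i : Fin T) (p : MemoryBasis n T × X) :
    swapPerm i p = ((p.1.1, p.1.2.2 i, Function.update p.1.2.2 i p.1.2.1), p.2) := rfl

/-- The permutation applied before query number `t` (counted from `0`). For `t = 0` it writes the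
first point; later it saves the answer to the previous query and replaces the point
`pt t x` in the query register by `pt (t + 1) x`. -/
def stepPerm {n T : ℕ} {X : Type} (pt : ℕ → X → Cube n) : ℕ → Equiv.Perm (MemoryBasis n T × X)
  | 0 => shiftPerm (pt 0)
  | t + 1 => if h : t < T then
      shiftPerm (fun x => pt t x + pt (t + 1) x) * swapPerm ⟨t, h⟩ else 1

/-- The memory after `t` queries, in the branch of the superposition with `X`-register `x`. -/
def memory {n T : ℕ} {X : Type} (pt : ℕ → X → Cube n) (c : BoolConcept n) (t : ℕ) (x : X) :
    Fin T → ZMod 2 :=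
  fun i => if (i : ℕ) < t then c (pt i x) else 0

lemma stepPerm_succ_apply {n T : ℕ} {X : Type} (pt : ℕ → X → Cube n) (c : BoolConcept n) {t : ℕ}
    (ht : t < T) (x : X) :
    stepPerm pt (t + 1) ((pt t x, c (pt t x), memory (T := T) pt c t x), x) =
      ((pt (t + 1) x, 0, memory pt c (t + 1) x), x) := by
  have h1 : pt t x + (pt t x + pt (t + 1) x) = pt (t + 1) x := by
    rw [← add_assoc, Cube.add_self, zero_add]
  have h2 : Function.update (memory (T := T) pt c t x) ⟨t, ht⟩ (c (pt t x)) =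
      memory pt c (t + 1) x := by
    funext i
    by_cases hi : i = ⟨t, ht⟩
    · subst hi
      simp [memory]
    · have hi' : (i : ℕ) ≠ t := fun h => hi (Fin.ext h)
      rw [Function.update_of_ne hi]
      simp only [memory]
      exact if_congr (by omega) rfl rfl
  simp only [stepPerm, dif_pos ht, Equiv.Perm.mul_apply, shiftPerm_apply, swapPerm_apply, h1, h2]
  simp [memory]

open Classical in
/-- A unitary `H` on a register `X`, followed by `T` queries to the points `pt 0 x, pt 1 x, …`
determined by the content `x` of the register, and by `H` again. The answers are kept, so that
only branches with the same answers interfere; `hpt` makes the last permutation clear the query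
register. -/
lemma exists_parallel_quantumAlgorithm {n T : ℕ} {O X : Type} [Fintype X] [DecidableEq X]
    (H : Matrix.unitaryGroup X ℂ) (x₀ : X) (pt : ℕ → X → Cube n) (hpt : ∀ x, pt T x = 0)
    (out : X → O) :
    ∃ A : QuantumAlgorithm n O, ∀ (c : BoolConcept n) (good : O → Prop),
      A.prob c T good = ∑ y : X, if good (out y) then
        ∑ z : Fin T → ZMod 2, ‖∑ x : X, if (∀ i : Fin T, c (pt i x) = z i) then
          (H : Matrix X X ℂ) y x * (H : Matrix X X ℂ) x x₀ else 0‖ ^ 2 else 0 := by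
  let d := Fintype.card ((Fin T → ZMod 2) × X)
  let e : ((Fin T → ZMod 2) × X) ≃ Fin d := Fintype.equivFin _
  let E : QBasis n d ≃ MemoryBasis n T × X :=
    { toFun := fun p => ((p.1, p.2.1, (e.symm p.2.2).1), (e.symm p.2.2).2)
      invFun := fun p => (p.1.1, p.1.2.1, e (p.1.2.2, p.2))
      left_inv := fun p => by simp
      right_inv := fun p => by simp }
  let D : ℕ → Matrix.unitaryGroup (QBasis n d) ℂ := fun t =>
    permUnitary ((E.trans (stepPerm pt t)).trans E.symm)
  let K := registerUnitary E H
  let U : ℕ → Matrix.unitaryGroup (QBasis n d) ℂ := fun t =>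
    (if t = T then K else 1) * (D t * (if t = 0 then K else 1))
  let A : QuantumAlgorithm n O := ⟨d, U, E.symm ((0, 0, 0), x₀), fun z => out (E z).2⟩
  refine ⟨A, fun c good => ?_⟩
  have hD : ∀ t p, (D t : Matrix (QBasis n d) (QBasis n d) ℂ).mulVec (Pi.single (E.symm p) 1) =
      Pi.single (E.symm (stepPerm pt t p)) 1 := fun t p => by
    rw [permUnitary_mulVec_single]
    simp
  -- the state just before query number `t`: one basis state for every value of the register `X`
  let φ : ℕ → QBasis n d → ℂ := fun t => ∑ x, (H : Matrix X X ℂ) x x₀ •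
    Pi.single (E.symm ((pt t x, 0, memory pt c t x), x)) 1
  have hstate : ∀ t ≤ T, A.state c t =
      ((if t = T then K else 1 : Matrix.unitaryGroup (QBasis n d) ℂ) :
        Matrix (QBasis n d) (QBasis n d) ℂ).mulVec (φ t) := by
    intro t
    induction t with
    | zero =>
      intro _
      show ((U 0 : Matrix.unitaryGroup (QBasis n d) ℂ) :
        Matrix (QBasis n d) (QBasis n d) ℂ).mulVec (Pi.single (E.symm ((0, 0, 0), x₀)) 1) = _
      simp only [U, if_true, Submonoid.coe_mul, ← Matrix.mulVec_mulVec]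
      rw [registerUnitary_mulVec_single, mulVec_sum_smul]
      congr 1
      refine Finset.sum_congr rfl fun x _ => ?_
      rw [hD]
      congr 3
      simp only [stepPerm, shiftPerm_apply, zero_add]
      rfl
    | succ t ih =>
      intro ht
      have htT : t < T := ht
      show ((U (t + 1) : Matrix.unitaryGroup (QBasis n d) ℂ) :
        Matrix (QBasis n d) (QBasis n d) ℂ).mulVec (quantumOracle c (A.state c t)) = _
      rw [ih htT.le, if_neg htT.ne]
      simp only [U, if_neg (Nat.succ_ne_zero t), mul_one, Submonoid.coe_mul,
        ← Matrix.mulVec_mulVec, OneMemClass.coe_one, Matrix.one_mulVec]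
      congr 1
      rw [quantumOracle_sum_smul, mulVec_sum_smul]
      refine Finset.sum_congr rfl fun x _ => ?_
      congr 1
      show (D (t + 1) : Matrix (QBasis n d) (QBasis n d) ℂ).mulVec (quantumOracle c
        (Pi.single (pt t x, 0, e (memory pt c t x, x)) 1)) = _
      rw [quantumOracle_single, zero_add, ← stepPerm_succ_apply pt c htT, ← hD]
      rfl
  have hamp : ∀ q b z y, A.state c T (E.symm ((q, b, z), y)) =
      if q = 0 ∧ b = 0 then ∑ x : X, if (∀ i : Fin T, c (pt i x) = z i) then
          (H : Matrix X X ℂ) y x * (H : Matrix X X ℂ) x x₀ else 0 else 0 := by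
    intro q b z y
    rw [hstate T le_rfl, if_pos rfl, mulVec_sum_smul, Finset.sum_apply]
    have hterm : ∀ x, ((H : Matrix X X ℂ) x x₀ • (K : Matrix (QBasis n d) (QBasis n d) ℂ).mulVec
        (Pi.single (E.symm ((pt T x, 0, memory pt c T x), x)) 1)) (E.symm ((q, b, z), y)) =
        if q = 0 ∧ b = 0 then (if (∀ i : Fin T, c (pt i x) = z i) then
          (H : Matrix X X ℂ) y x * (H : Matrix X X ℂ) x x₀ else 0) else 0 := by
      intro x
      rw [Pi.smul_apply, Matrix.mulVec_single_one, Matrix.col_apply, registerUnitary_apply, hpt]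
      have hmem : z = memory pt c T x ↔ ∀ i : Fin T, c (pt i x) = z i := by
        rw [funext_iff]
        refine forall_congr' fun i => ?_
        simp [memory, eq_comm]
      simp only [Prod.mk.injEq, hmem, smul_eq_mul, ← and_assoc, ite_and,
        mul_comm ((H : Matrix X X ℂ) x x₀)]
      simp only [ite_mul, zero_mul]
    simp only [hterm]
    split_ifs <;> simp
  have hprob : A.prob c T good =
      ∑ p : MemoryBasis n T × X, if good (out p.2) then ‖A.state c T (E.symm p)‖ ^ 2 else 0 := by
    rw [QuantumAlgorithm.prob, ← E.symm.sum_comp]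
    refine Finset.sum_congr rfl fun p _ => ?_
    show (if good (out (E (E.symm p)).2) then _ else _) = _
    rw [Equiv.apply_symm_apply]
  rw [hprob, Fintype.sum_prod_type_right]
  refine Finset.sum_congr rfl fun y _ => ?_
  split_ifs
  · rw [Fintype.sum_prod_type, Finset.sum_eq_single 0 _ (by simp), Fintype.sum_prod_type,
      Finset.sum_eq_single 0 _ (by simp)]
    · simp [hamp]
    · intro b _ hb
      simp [hamp, hb]
    · intro q _ hq
      simp [hamp, hq]
  · simp

/-! ### Signs and the Hadamard transform -/

/-- The nontrivial character `a ↦ (-1)^a` of `𝔽₂`. -/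
def binarySign (a : ZMod 2) : ℝ := if a = 0 then 1 else -1

@[simp] lemma binarySign_zero : binarySign 0 = 1 := by simp [binarySign]

lemma binarySign_of_ne_zero {a : ZMod 2} (h : a ≠ 0) : binarySign a = -1 := by
  simp [binarySign, h]

lemma binarySign_add (a b : ZMod 2) : binarySign (a + b) = binarySign a * binarySign b := by
  have h : ∀ a b : ZMod 2, a ≠ 0 → b ≠ 0 → a + b = 0 := by decide
  by_cases ha : a = 0
  · simp [ha]
  · by_cases hb : b = 0
    · simp [hb]
    · rw [h a b ha hb, binarySign_of_ne_zero ha, binarySign_of_ne_zero hb]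
      simp

open Classical in
/-- Orthogonality of characters on a subspace `K`. -/
lemma sum_binarySign_dotProduct {κ : Type*} [Fintype κ] [DecidableEq κ]
    (K : Submodule (ZMod 2) (κ → ZMod 2)) (y : κ → ZMod 2) :
    ∑ v : κ → ZMod 2, (if v ∈ K then binarySign (v ⬝ᵥ y) else 0) =
      if (∀ v ∈ K, v ⬝ᵥ y = 0) then (Nat.card K : ℝ) else 0 := by
  split_ifs with h
  · rw [Nat.card_eq_fintype_card, Fintype.card_subtype, Finset.cast_card, Finset.sum_filter]
    refine Finset.sum_congr rfl fun v _ => ?_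
    by_cases hv : v ∈ K
    · simp [hv, h v hv]
    · simp [hv]
  · push Not at h
    obtain ⟨w, hw, hwy⟩ := h
    -- translation by `w` changes the sign of the sum
    have hneg : ∑ v : κ → ZMod 2, (if v ∈ K then binarySign (v ⬝ᵥ y) else 0) =
        -∑ v : κ → ZMod 2, (if v ∈ K then binarySign (v ⬝ᵥ y) else 0) := by
      rw [← Finset.sum_neg_distrib, ← Equiv.sum_comp (Equiv.addRight w)]
      refine Finset.sum_congr rfl fun v _ => ?_
      rw [Equiv.coe_addRight, Submodule.add_mem_iff_left K hw, add_dotProduct, binarySign_add,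
        binarySign_of_ne_zero hwy]
      split_ifs <;> simp
    linarith

lemma sum_binarySign_dotProduct_univ {κ : Type*} [Fintype κ] [DecidableEq κ] (y : κ → ZMod 2) :
    ∑ v : κ → ZMod 2, binarySign (v ⬝ᵥ y) =
      if y = 0 then (Nat.card (κ → ZMod 2) : ℝ) else 0 := by
  classical
  have h := sum_binarySign_dotProduct (⊤ : Submodule (ZMod 2) (κ → ZMod 2)) y
  simp only [Submodule.mem_top, if_true, true_implies] at h
  rw [h, Nat.card_congr (Equiv.subtypeUnivEquiv fun _ : κ → ZMod 2 => trivial)]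
  refine if_congr ⟨fun h => ?_, fun h => by simp [h]⟩ rfl rfl
  funext i
  simpa using h (Pi.single i 1)

open Classical in
/-- A subspace and its orthogonal complement have complementary sizes. -/
lemma card_mul_card_orthogonal {κ : Type*} [Fintype κ] [DecidableEq κ]
    (K : Submodule (ZMod 2) (κ → ZMod 2)) :
    Nat.card K * (Finset.univ.filter fun y : κ → ZMod 2 => ∀ v ∈ K, v ⬝ᵥ y = 0).card =
      Nat.card (κ → ZMod 2) := by
  have h : ∑ y : κ → ZMod 2, ∑ v : κ → ZMod 2, (if v ∈ K then binarySign (v ⬝ᵥ y) else 0) =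
      Nat.card (κ → ZMod 2) := by
    rw [Finset.sum_comm, Finset.sum_eq_single 0]
    · simp [Nat.card_eq_fintype_card]
    · intro v _ hv
      split_ifs
      · simp only [dotProduct_comm v]
        rw [sum_binarySign_dotProduct_univ, if_neg hv]
      · simp
    · simp
  simp only [sum_binarySign_dotProduct] at h
  rw [← Finset.sum_filter, Finset.sum_const, nsmul_eq_mul, mul_comm] at h
  exact_mod_cast h

/-- The Hadamard transform on `κ → 𝔽₂`. -/
noncomputable def hadamardUnitary (κ : Type*) [Fintype κ] [DecidableEq κ] :
    Matrix.unitaryGroup (κ → ZMod 2) ℂ :=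
  ⟨Matrix.of fun y x => (((√(Nat.card (κ → ZMod 2) : ℝ))⁻¹ * binarySign (x ⬝ᵥ y) : ℝ) : ℂ), by
    rw [Matrix.mem_unitaryGroup_iff]
    ext y y'
    rw [Matrix.mul_apply, Matrix.one_apply]
    have hN : (0 : ℝ) < Nat.card (κ → ZMod 2) := by exact_mod_cast Nat.card_pos
    have hterm : ∀ x : κ → ZMod 2, (√(Nat.card (κ → ZMod 2) : ℝ))⁻¹ * binarySign (x ⬝ᵥ y) *
        ((√(Nat.card (κ → ZMod 2) : ℝ))⁻¹ * binarySign (x ⬝ᵥ y')) =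
        (Nat.card (κ → ZMod 2) : ℝ)⁻¹ * binarySign (x ⬝ᵥ (y + y')) := fun x => by
      rw [dotProduct_add, binarySign_add, mul_mul_mul_comm, ← mul_inv, Real.mul_self_sqrt hN.le]
    simp only [Matrix.of_apply, Matrix.star_apply, RCLike.star_def, Complex.conj_ofReal,
      ← Complex.ofReal_mul, hterm, ← Complex.ofReal_sum]
    rw [← Finset.mul_sum, sum_binarySign_dotProduct_univ]
    have hyy : y + y' = 0 ↔ y = y' := by
      have hneg : -y' = y' := funext fun i => CharTwo.neg_eq (y' i)
      rw [add_eq_zero_iff_eq_neg, hneg]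
    by_cases h : y = y'
    · rw [if_pos (hyy.2 h), if_pos h, inv_mul_cancel₀ hN.ne', Complex.ofReal_one]
    · rw [if_neg (fun h' => h (hyy.1 h')), if_neg h, mul_zero, Complex.ofReal_zero]⟩

lemma hadamardUnitary_apply {κ : Type*} [Fintype κ] [DecidableEq κ] (y x : κ → ZMod 2) :
    (hadamardUnitary κ : Matrix (κ → ZMod 2) (κ → ZMod 2) ℂ) y x =
      (((√(Nat.card (κ → ZMod 2) : ℝ))⁻¹ * binarySign (x ⬝ᵥ y) : ℝ) : ℂ) := rfl

open Classical in
/-- Fourier sampling: if the fibres of `F` are the cosets of `K`, the measured distribution is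
uniform on the orthogonal complement of `K`. -/
lemma fourierSampling_prob {κ Z : Type*} [Fintype κ] [DecidableEq κ] [Fintype Z]
    (K : Submodule (ZMod 2) (κ → ZMod 2)) (F : (κ → ZMod 2) → Z)
    (hF : ∀ x x', F x = F x' ↔ x - x' ∈ K) (y : κ → ZMod 2) :
    ∑ z : Z, ‖∑ x : κ → ZMod 2, if F x = z then
        (hadamardUnitary κ : Matrix (κ → ZMod 2) (κ → ZMod 2) ℂ) y x *
        (hadamardUnitary κ : Matrix (κ → ZMod 2) (κ → ZMod 2) ℂ) x 0 else 0‖ ^ 2 =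
      if (∀ v ∈ K, v ⬝ᵥ y = 0) then (Nat.card K : ℝ) / Nat.card (κ → ZMod 2) else 0 := by
  set N : ℝ := ((Nat.card (κ → ZMod 2) : ℕ) : ℝ) with hN
  have hNpos : 0 < N := by
    rw [hN]
    exact_mod_cast Nat.card_pos
  have hamp : ∀ z, ‖∑ x : κ → ZMod 2, if F x = z then
        (hadamardUnitary κ : Matrix (κ → ZMod 2) (κ → ZMod 2) ℂ) y x *
        (hadamardUnitary κ : Matrix (κ → ZMod 2) (κ → ZMod 2) ℂ) x 0 else 0‖ ^ 2 =
      (N⁻¹) ^ 2 * ∑ x : κ → ZMod 2, ∑ v : κ → ZMod 2,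
        if F x = z then (if v ∈ K then binarySign (v ⬝ᵥ y) else 0) else 0 := by
    intro z
    have h1 : (∑ x : κ → ZMod 2, if F x = z then
        (hadamardUnitary κ : Matrix (κ → ZMod 2) (κ → ZMod 2) ℂ) y x *
        (hadamardUnitary κ : Matrix (κ → ZMod 2) (κ → ZMod 2) ℂ) x 0 else 0) =
        ((N⁻¹ * ∑ x : κ → ZMod 2, if F x = z then binarySign (x ⬝ᵥ y) else 0 : ℝ) : ℂ) := by
      rw [Finset.mul_sum, Complex.ofReal_sum]
      refine Finset.sum_congr rfl fun x _ => ?_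
      split_ifs
      · rw [hadamardUnitary_apply, hadamardUnitary_apply, ← Complex.ofReal_mul, zero_dotProduct,
          binarySign_zero, mul_one, mul_right_comm, ← mul_inv, Real.mul_self_sqrt hNpos.le]
      · simp
    rw [h1, Complex.norm_real, Real.norm_eq_abs, sq_abs, mul_pow, sq (∑ x, _), Finset.sum_mul_sum]
    congr 1
    refine Finset.sum_congr rfl fun x _ => ?_
    rw [← Equiv.sum_comp (Equiv.addLeft x)]
    refine Finset.sum_congr rfl fun v _ => ?_
    rw [Equiv.coe_addLeft]
    by_cases hx : F x = z
    · have hv : F (x + v) = z ↔ v ∈ K := by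
        rw [← hx, hF, add_sub_cancel_left]
      have hsq : binarySign (x ⬝ᵥ y) * binarySign (x ⬝ᵥ y) = 1 := by
        rw [← binarySign_add, CharTwo.add_self_eq_zero, binarySign_zero]
      simp only [hx, hv, if_true, add_dotProduct, binarySign_add]
      split_ifs
      · rw [← mul_assoc, hsq, one_mul]
      · simp
    · simp [hx]
  simp only [hamp]
  rw [← Finset.mul_sum, Finset.sum_comm]
  have hsum : ∀ x : κ → ZMod 2, (∑ z : Z, ∑ v : κ → ZMod 2,
      if F x = z then (if v ∈ K then binarySign (v ⬝ᵥ y) else 0) else 0) =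
      if (∀ v ∈ K, v ⬝ᵥ y = 0) then (Nat.card K : ℝ) else 0 := by
    intro x
    rw [Finset.sum_comm, ← sum_binarySign_dotProduct]
    simp
  simp only [hsum]
  rw [Finset.sum_const, Finset.card_univ, ← Nat.card_eq_fintype_card, nsmul_eq_mul, ← hN]
  split_ifs
  · field_simp
  · simp

/-! ### Recovering the hidden subspace from samples -/

/-- The vectors orthogonal to each of the `k` rows of `y`. -/
def commonKernel {k m : ℕ} (y : Fin k × Fin m → ZMod 2) : Submodule (ZMod 2) (Cube m) where
  carrier := {w | ∀ i, ∑ j, w j * y (i, j) = 0}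
  add_mem' := by
    intro a b ha hb i
    simp [add_mul, Finset.sum_add_distrib, ha i, hb i]
  zero_mem' := by
    intro i
    simp
  smul_mem' := by
    intro r a ha i
    simp [mul_assoc, ← Finset.mul_sum, ha i]

/-- The `k`-fold power of `V`, as a space of matrices with rows in `V`. -/
def rowSpace {m : ℕ} (k : ℕ) (V : Submodule (ZMod 2) (Cube m)) :
    Submodule (ZMod 2) (Fin k × Fin m → ZMod 2) where
  carrier := {x | ∀ i, (fun j => x (i, j)) ∈ V}
  add_mem' := fun ha hb i => V.add_mem (ha i) (hb i)
  zero_mem' := fun _ => V.zero_mem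
  smul_mem' := fun r _ ha i => V.smul_mem r (ha i)

lemma mem_rowSpace {k m : ℕ} {V : Submodule (ZMod 2) (Cube m)} {x : Fin k × Fin m → ZMod 2} :
    x ∈ rowSpace k V ↔ ∀ i, (fun j => x (i, j)) ∈ V := Iff.rfl

lemma card_rowSpace {m : ℕ} (k : ℕ) (V : Submodule (ZMod 2) (Cube m)) :
    Nat.card (rowSpace k V) = Nat.card V ^ k := by
  have e : rowSpace k V ≃ (Fin k → V) :=
    { toFun := fun x i => ⟨fun j => x.1 (i, j), x.2 i⟩
      invFun := fun g => ⟨fun p => (g p.1).1 p.2, fun i => (g i).2⟩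
      left_inv := fun _ => rfl
      right_inv := fun _ => rfl }
  rw [Nat.card_congr e, Nat.card_fun, Nat.card_eq_fintype_card (α := Fin k), Fintype.card_fin]

lemma orthogonal_rowSpace_iff {k m : ℕ} (V : Submodule (ZMod 2) (Cube m))
    (y : Fin k × Fin m → ZMod 2) :
    (∀ x ∈ rowSpace k V, x ⬝ᵥ y = 0) ↔ V ≤ commonKernel y := by
  constructor
  · intro h w hw i
    have h1 := h (fun p => if p.1 = i then w p.2 else 0) fun i' => by
      by_cases hi : i' = i
      · simpa [hi] using hw
      · simp only [hi, if_false]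
        exact V.zero_mem
    rw [dotProduct, Fintype.sum_prod_type, Finset.sum_eq_single i] at h1
    · simpa using h1
    · intro i' _ hi
      simp [hi]
    · simp
  · intro h x hx
    rw [dotProduct, Fintype.sum_prod_type]
    exact Finset.sum_eq_zero fun i _ => h (hx i) i

open Classical in
lemma card_pow_mul_card_le_commonKernel {m : ℕ} (k : ℕ) (V : Submodule (ZMod 2) (Cube m)) :
    Nat.card V ^ k * (Finset.univ.filter fun y : Fin k × Fin m → ZMod 2 =>
      V ≤ commonKernel y).card = Nat.card (Fin k × Fin m → ZMod 2) := by
  rw [← card_rowSpace, ← card_mul_card_orthogonal (rowSpace k V)]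
  simp only [orthogonal_rowSpace_iff]

lemma two_mul_card_le_card_sup_span {m : ℕ} {V : Submodule (ZMod 2) (Cube m)} {w : Cube m}
    (hw : w ∉ V) : 2 * Nat.card V ≤ Nat.card (V ⊔ ZMod 2 ∙ w : Submodule (ZMod 2) (Cube m)) := by
  have hlt : V < V ⊔ ZMod 2 ∙ w := by
    refine lt_of_le_of_ne le_sup_left fun h => hw ?_
    rw [h]
    exact Submodule.mem_sup_right (Submodule.mem_span_singleton_self w)
  rw [card_submodule, card_submodule, ← pow_succ']
  exact Nat.pow_le_pow_right (by norm_num) (Submodule.finrank_lt_finrank_of_lt hlt)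

open Classical in
/-- For a fixed `w ∉ V`, all `k` samples from the orthogonal complement of `V` are orthogonal to `w`
with probability at most `2^(-k)`; the union bound is over all `w`. -/
lemma card_bad_samples_le {m : ℕ} (k : ℕ) (V : Submodule (ZMod 2) (Cube m)) :
    Nat.card V ^ k * (Finset.univ.filter fun y : Fin k × Fin m → ZMod 2 =>
      V ≤ commonKernel y ∧ commonKernel y ≠ V).card * 2 ^ k ≤
      2 ^ m * Nat.card (Fin k × Fin m → ZMod 2) := by
  have hsub : (Finset.univ.filter fun y : Fin k × Fin m → ZMod 2 =>
      V ≤ commonKernel y ∧ commonKernel y ≠ V) ⊆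
      (Finset.univ.filter fun w : Cube m => w ∉ V).biUnion fun w =>
        Finset.univ.filter fun y : Fin k × Fin m → ZMod 2 => V ⊔ ZMod 2 ∙ w ≤ commonKernel y := by
    intro y hy
    simp only [Finset.mem_filter, Finset.mem_univ, true_and] at hy
    obtain ⟨w, hwy, hwV⟩ := SetLike.exists_of_lt (lt_of_le_of_ne hy.1 hy.2.symm)
    simp only [Finset.mem_biUnion, Finset.mem_filter, Finset.mem_univ, true_and]
    exact ⟨w, hwV, sup_le hy.1 ((Submodule.span_singleton_le_iff_mem _ _).2 hwy)⟩
  have hone : ∀ w ∉ V, (Finset.univ.filter fun y : Fin k × Fin m → ZMod 2 =>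
      V ⊔ ZMod 2 ∙ w ≤ commonKernel y).card * (2 * Nat.card V) ^ k ≤
      Nat.card (Fin k × Fin m → ZMod 2) := by
    intro w hw
    rw [← card_pow_mul_card_le_commonKernel k (V ⊔ ZMod 2 ∙ w), mul_comm]
    exact Nat.mul_le_mul_right _ (Nat.pow_le_pow_left (two_mul_card_le_card_sup_span hw) k)
  calc _ = (Finset.univ.filter fun y : Fin k × Fin m → ZMod 2 =>
      V ≤ commonKernel y ∧ commonKernel y ≠ V).card * (2 * Nat.card V) ^ k := by
        rw [mul_pow]
        ring
    _ ≤ (∑ w ∈ Finset.univ.filter fun w : Cube m => w ∉ V,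
        (Finset.univ.filter fun y : Fin k × Fin m → ZMod 2 =>
          V ⊔ ZMod 2 ∙ w ≤ commonKernel y).card) * (2 * Nat.card V) ^ k :=
        Nat.mul_le_mul_right _ ((Finset.card_le_card hsub).trans Finset.card_biUnion_le)
    _ ≤ ∑ w ∈ Finset.univ.filter fun w : Cube m => w ∉ V, Nat.card (Fin k × Fin m → ZMod 2) := by
        rw [Finset.sum_mul]
        exact Finset.sum_le_sum fun w hw => hone w (Finset.mem_filter.1 hw).2
    _ ≤ _ := by
        rw [Finset.sum_const, smul_eq_mul]
        refine Nat.mul_le_mul_right _ ((Finset.card_le_univ _).trans ?_)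
        rw [← Nat.card_eq_fintype_card, card_cube]

open Classical in
lemma card_good_samples_ge {m : ℕ} (V : Submodule (ZMod 2) (Cube m)) :
    (2 / 3 : ℝ) ≤ (Finset.univ.filter fun y : Fin (m + 2) × Fin m → ZMod 2 =>
        commonKernel y = V).card *
      ((Nat.card V : ℝ) ^ (m + 2) / Nat.card (Fin (m + 2) × Fin m → ZMod 2)) := by
  set N := Nat.card (Fin (m + 2) × Fin m → ZMod 2) with hN
  have hNpos : (0 : ℝ) < N := by
    rw [hN]
    exact_mod_cast Nat.card_pos
  set a := Nat.card V ^ (m + 2) with ha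
  set G := (Finset.univ.filter fun y : Fin (m + 2) × Fin m → ZMod 2 => commonKernel y = V).card
  set B := (Finset.univ.filter fun y : Fin (m + 2) × Fin m → ZMod 2 =>
      V ≤ commonKernel y ∧ commonKernel y ≠ V).card
  have htot : a * (G + B) = N := by
    rw [hN, ← card_pow_mul_card_le_commonKernel (m + 2) V, ← Finset.card_union_of_disjoint]
    · congr 2
      ext y
      simp only [Finset.mem_union, Finset.mem_filter, Finset.mem_univ, true_and]
      by_cases h : commonKernel y = V
      · simp [h]
      · simp [h]
    · refine Finset.disjoint_filter.2 fun y _ h h' => h'.2 h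
  have hbad : a * B * 4 ≤ N := by
    have h := card_bad_samples_le (m + 2) V
    rw [← hN, pow_add 2 m 2] at h
    refine Nat.le_of_mul_le_mul_left ?_ (by positivity : 0 < 2 ^ m)
    calc _ = a * B * (2 ^ m * 2 ^ 2) := by ring
      _ ≤ _ := h
  have h3 : 2 * N ≤ 3 * (a * G) := by
    rw [mul_add] at htot
    omega
  have h4 : (2 : ℝ) * N ≤ 3 * ((Nat.card V : ℝ) ^ (m + 2) * G) := by exact_mod_cast h3
  rw [mul_div_assoc', le_div_iff₀ hNpos]
  linarith

/-- Simon's algorithm with `m + 2` parallel samples, each of which costs `m` queries. -/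
lemma quantumLearnable_invariant (m ℓ : ℕ) :
    QuantumLearnable (invariantClass m ℓ) (invariantPartition m ℓ) ((m + 2) * m) := by
  classical
  -- query number `i * m + j` asks for the bit `j` of the value at the `i`-th row of `x`
  let pt : ℕ → (Fin (m + 2) × Fin m → ZMod 2) → Cube (inputLength m) := fun t x =>
    if h : t < (m + 2) * m then
      encodeInput (fun j => x ((finProdFinEquiv.symm ⟨t, h⟩).1, j)) (finProdFinEquiv.symm ⟨t, h⟩).2
    else 0
  obtain ⟨A, hA⟩ := exists_parallel_quantumAlgorithm (T := (m + 2) * m)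
    (hadamardUnitary (Fin (m + 2) × Fin m)) 0 pt (fun x => dif_neg (lt_irrefl _))
    (fun y => invariantPiece (commonKernel y))
  refine ⟨A, ?_⟩
  rintro _ ⟨V, hV, f, hf, rfl⟩
  let F : (Fin (m + 2) × Fin m → ZMod 2) → (Fin ((m + 2) * m) → ZMod 2) := fun x i =>
    bitConcept f (pt i x)
  have hFx : ∀ x (i : Fin (m + 2)) (j : Fin m),
      F x (finProdFinEquiv (i, j)) = f (fun j => x (i, j)) j := by
    intro x i j
    simp only [F, pt, dif_pos (finProdFinEquiv (i, j)).2, Fin.eta, Equiv.symm_apply_apply,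
      bitConcept_encodeInput]
  have hF : ∀ x x', F x = F x' ↔ x - x' ∈ rowSpace (m + 2) V := by
    intro x x'
    rw [mem_rowSpace]
    constructor
    · intro h i
      refine (hf.eq_iff_sub_mem (fun j => x (i, j)) (fun j => x' (i, j))).1 (funext fun j => ?_)
      rw [← hFx, h, hFx]
    · intro h
      funext p
      obtain ⟨⟨i, j⟩, rfl⟩ := finProdFinEquiv.surjective p
      rw [hFx, hFx, (hf.eq_iff_sub_mem (fun j => x (i, j)) (fun j => x' (i, j))).2 (h i)]
  have hgood : ∀ y : Fin (m + 2) × Fin m → ZMod 2, CorrectPiece (invariantPartition m ℓ)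
      (bitConcept f) (invariantPiece (commonKernel y)) ↔ commonKernel y = V := by
    intro y
    constructor
    · exact fun h => eq_of_mem_invariantPiece h.2 ⟨f, hf, rfl⟩
    · intro h
      rw [h]
      exact ⟨⟨V, hV, rfl⟩, f, hf, rfl⟩
  have hcond : ∀ x z, (∀ i : Fin ((m + 2) * m), bitConcept f (pt i x) = z i) ↔ F x = z :=
    fun x z => funext_iff.symm
  rw [hA]
  refine (card_good_samples_ge V).trans (le_of_eq ?_)
  rw [← nsmul_eq_mul, ← Finset.sum_const, Finset.sum_filter]
  refine Finset.sum_congr rfl fun y _ => ?_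
  by_cases h : commonKernel y = V
  · have hy := fourierSampling_prob (rowSpace (m + 2) V) F hF y
    rw [if_pos ((orthogonal_rowSpace_iff V y).2 h.ge), card_rowSpace, Nat.cast_pow] at hy
    rw [if_pos h, if_pos ((hgood y).2 h), ← hy]
    refine Finset.sum_congr rfl fun z _ => ?_
    congr 2
    refine Finset.sum_congr rfl fun x _ => ?_
    by_cases hz : F x = z
    · rw [if_pos hz, if_pos ((hcond x z).2 hz)]
    · rw [if_neg hz, if_neg fun h' => hz ((hcond x z).1 h')]
  · rw [if_neg h, if_neg fun h' => h ((hgood y).1 h')]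

lemma quantumComplexity_invariant_le (m ℓ : ℕ) :
    quantumComplexity (invariantClass m ℓ) (invariantPartition m ℓ) ≤ (m + 2) * m :=
  Nat.sInf_le (quantumLearnable_invariant m ℓ)

/-! ### The superpolynomial gap -/

/-- If `m - ℓ(m) = ω(log m)`, the classical complexity exceeds every power of `m`. -/
lemma eventually_pow_lt_classicalComplexity {ℓ : ℕ → ℕ} (hℓ : ∀ᶠ m in atTop, 1 ≤ ℓ m ∧ ℓ m < m)
    (h : (fun m : ℕ => Real.log (m : ℝ)) =o[atTop] (fun m : ℕ => (m : ℝ) - (ℓ m : ℝ))) (k : ℕ) :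
    ∀ᶠ m in atTop,
      m ^ k < classicalComplexity (invariantClass m (ℓ m)) (invariantPartition m (ℓ m)) := by
  -- one power of `m` more than needed, to absorb the factor `1/3`
  have hc : (0 : ℝ) < Real.log 2 / (3 * (k + 1)) :=
    div_pos (Real.log_pos (by norm_num)) (by positivity)
  filter_upwards [hℓ, h.bound hc, eventually_gt_atTop 3] with m hm hlog hm3
  have hm0 : (0 : ℝ) < m := by exact_mod_cast (by omega : 0 < m)
  have hml : (0 : ℝ) ≤ (m : ℝ) - ℓ m := by
    have : (ℓ m : ℝ) ≤ m := by exact_mod_cast hm.2.le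
    linarith
  rw [Real.norm_of_nonneg (Real.log_nonneg (by exact_mod_cast (by omega : 1 ≤ m))),
    Real.norm_of_nonneg hml] at hlog
  have hle : (m : ℝ) ^ (k + 1) ≤ (2 : ℝ) ^ (((m : ℝ) - (ℓ m : ℝ)) / 3) := by
    rw [← Real.log_le_log_iff (by positivity) (by positivity), Real.log_pow,
      Real.log_rpow (by norm_num)]
    have h2 := mul_le_mul_of_nonneg_left hlog (by positivity : (0 : ℝ) ≤ k + 1)
    push_cast
    refine h2.trans (le_of_eq ?_)
    field_simp
  have hlow := rpow_le_classicalComplexity hm.1 hm.2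
  have hlt : (m : ℝ) ^ k < (1 / 3) * (m : ℝ) ^ (k + 1) := by
    have h3 : (3 : ℝ) < m := by exact_mod_cast hm3
    rw [pow_succ]
    have hpos : (0 : ℝ) < (m : ℝ) ^ k := by positivity
    nlinarith
  have hfin : (m : ℝ) ^ k <
      (classicalComplexity (invariantClass m (ℓ m)) (invariantPartition m (ℓ m)) : ℝ) := by
    linarith
  exact_mod_cast hfin

theorem mainTheorem5 :
    -- the class, its partition, and the two cardinality bounds
    -- (for `ℓ < m` none of the natural subtractions in the exponents truncates)
    (∀ m ℓ : ℕ, 1 ≤ ℓ → ℓ < m →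
      IsConceptPartition (invariantClass m ℓ) (invariantPartition m ℓ) ∧
      (invariantClass m ℓ).ncard < 2 ^ (m * ℓ - ℓ ^ 2 + ℓ + m * 2 ^ (m - ℓ)) ∧
      2 ^ (m * ℓ - ℓ ^ 2 - ℓ) < (invariantPartition m ℓ).ncard) ∧
    -- the classical lower bound, with an absolute constant
    (∃ κ : ℝ, 0 < κ ∧ ∀ m ℓ : ℕ, 1 ≤ ℓ → ℓ < m →
      κ * (2 : ℝ) ^ (((m : ℝ) - (ℓ : ℝ)) / 3) ≤
        (classicalComplexity (invariantClass m ℓ) (invariantPartition m ℓ) : ℝ)) ∧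
    -- the quantum upper bound, with one polynomial for all `m` and `ℓ`
    (∃ p : Polynomial ℕ, ∀ m ℓ : ℕ, 1 ≤ ℓ → ℓ < m →
      (∃ T : ℕ, QuantumLearnable (invariantClass m ℓ) (invariantPartition m ℓ) T) ∧
      quantumComplexity (invariantClass m ℓ) (invariantPartition m ℓ) ≤ p.eval m) ∧
    -- the superpolynomial gap when `m - ℓ(m) = ω(log m)`
    (∀ ℓ : ℕ → ℕ, (∀ᶠ m in atTop, 1 ≤ ℓ m ∧ ℓ m < m) →
      (fun m : ℕ => Real.log (m : ℝ)) =o[atTop] (fun m : ℕ => (m : ℝ) - (ℓ m : ℝ)) →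
      ∀ k : ℕ, ∀ᶠ m in atTop,
        m ^ k < classicalComplexity (invariantClass m (ℓ m)) (invariantPartition m (ℓ m)) ∧
        quantumComplexity (invariantClass m (ℓ m)) (invariantPartition m (ℓ m)) ^ k <
          classicalComplexity (invariantClass m (ℓ m)) (invariantPartition m (ℓ m))) := by

  refine ⟨fun m ℓ h1 h2 => ⟨isConceptPartition_invariant m ℓ, ncard_invariantClass_lt h1 h2,
      lt_ncard_invariantPartition h1 h2⟩,
    ⟨1 / 3, by norm_num, fun m ℓ h1 h2 => rpow_le_classicalComplexity h1 h2⟩,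
    ⟨(Polynomial.X + 2) * Polynomial.X, fun m ℓ _ _ =>
      ⟨⟨_, quantumLearnable_invariant m ℓ⟩, by simpa using quantumComplexity_invariant_le m ℓ⟩⟩,
    fun ℓ hℓ h k => ?_⟩
  filter_upwards [eventually_pow_lt_classicalComplexity hℓ h k,
    eventually_pow_lt_classicalComplexity hℓ h (3 * k), eventually_ge_atTop 2] with m hm hm3 h2
  refine ⟨hm, lt_of_le_of_lt ?_ hm3⟩
  rw [pow_mul]
  refine Nat.pow_le_pow_left ((quantumComplexity_invariant_le m (ℓ m)).trans ?_) k
  -- `(m + 2) * m ≤ m ^ 3` as soon as `m ≥ 2`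
  have h3 : m + 2 ≤ m * m := by nlinarith
  calc (m + 2) * m ≤ m * m * m := Nat.mul_le_mul_right _ h3
    _ = m ^ 3 := by ring
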